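/- Let $\mathbb K=\mathbb R$ or $\mathbb C$ and let $n\ge 5$. A closed $n$-gon is a sequence of points $v_i\in\mathbb{P}^2(\mathbb K)$, $i\in\mathbb Z$, with $v_{i+n}=v_i$; we assume that any four consecutive points are in general position (no three of them collinear). Its corner invariants $x_1,\dots,x_{2n}\in\mathbb K\setminus\{0\}$ (indices modulo $2n$) are $$x_{2i-1}=\bigl[v_{i-2},\,v_{i-1},\,(v_{i-2},v_{i-1})\cap(v_i,v_{i+1}),\,(v_{i-2},v_{i-1})\cap(v_{i+1},v_{i+2})\bigr],$$ $$x_{2i}=\bigl[v_{i+2},\,v_{i+1},\,(v_{i+2},v_{i+1})\cap(v_i,v_{i-1}),\,(v_{i+2},v_{i+1})\cap(v_{i-1},v_{i-2})\bigr],$$ where $(v,w)$ is the line through $v$ and $w$ and $[t_1,t_2,t_3,t_4]=\frac{(t_1-t_2)(t_3-t_4)}{(t_1-t_3)(t_2-t_4)}$ in any affine parameter of the line. Let $\mathcal C_n\subset\mathbb K^{2n}$ be the set of all $(x_1,\dots,x_{2n})$ obtained from closed $n$-gons in this way. The monodromy invariants are the following polynomials in $x_1,\dots,x_{2n}$. Put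 $X_i=x_{i-1}x_ix_{i+1}$, and let $\{\cdot,\cdot\}$ be the Poisson bracket on polynomials with $\{x_i,x_{i+2}\}=(-1)^i x_ix_{i+2}$ and all other brackets of coordinates equal to zero. A monomial $X_{i_1}\cdots X_{i_s}x_{j_1}\cdots x_{j_t}$ (with distinct $i_r$ and distinct $j_r$) is admissible if the Poisson brackets of any two of the factors $X_{i_r}$, $x_{j_r}$ vanish. For $0\le k\le[n/2]$ let $O_k$ be the sum of $(-1)^t X_{i_1}\cdots X_{i_s}x_{j_1}\cdots x_{j_t}$ over all admissible monomials with $s+t=k$, all $i_r$ even and all $j_r$ odd; let $E_k$ be defined in the same way with all $i_r$ odd and all $j_r$ even. In particular $O_0=E_0=1$. Finally let $O_n=x_1x_3\cdots x_{2n-1}$ and $E_n=x_2x_4\cdots x_{2n}$. **Theorem.** At every point of $\mathcal C_n$ there are cube roots $O_n^{1/3}$ and $E_n^{1/3}$, both nonzero (the real ones if $\mathbb K=\mathbb R$; compatibly chosen ones, the same in all the formulas below, if $\mathbb K=\mathbb C$), such that the following holds. (i) The monodromy invariants satisfy the five identities $$\sum_{j=0}^{[n/2]}O_j=3E_n^{1/3}O_n^{2/3},\qquad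 \sum_{j=0}^{[n/2]}E_j=3E_n^{2/3}O_n^{1/3},$$ $$\sum_{j=1}^{[n/2]}j\,O_j=n\,E_n^{1/3}O_n^{2/3},\qquad \sum_{j=1}^{[n/2]}j\,E_j=n\,E_n^{2/3}O_n^{1/3},$$ $$E_n^{1/3}\sum_{j=1}^{[n/2]}j^2O_j=O_n^{1/3}\sum_{j=1}^{[n/2]}j^2E_j .$$ (ii) The differentials of the monodromy invariants, as covectors on the whole space $\mathbb K^{2n}$ at the given point of $\mathcal C_n$, satisfy the three identities $$\sum_{j=1}^{[n/2]}dO_j=2E_n^{1/3}O_n^{-1/3}\,dO_n+E_n^{-2/3}O_n^{2/3}\,dE_n,$$ $$\sum_{j=1}^{[n/2]}dE_j=2E_n^{-1/3}O_n^{1/3}\,dE_n+E_n^{2/3}O_n^{-2/3}\,dO_n,$$ $$O_n^{1/3}\sum_{j=1}^{[n/2]}j\,dE_j+E_n^{1/3}\sum_{j=1}^{[n/2]}j\,dO_j=n\,E_n^{2/3}O_n^{2/3}\left(E_n^{-1}dE_n+O_n^{-1}dO_n\right).$$ -/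

import Mathlib

open scoped LinearAlgebra.Projectivization
open MvPolynomial

noncomputable section

/-! ### Closed polygons in the projective plane and their corner invariants -/

section Geometry

variable {𝕜 : Type*} [RCLike 𝕜]

/-- The projective plane over `𝕜`. -/
abbrev ProjPlane (𝕜 : Type*) [RCLike 𝕜] : Type _ := ℙ 𝕜 (Fin 3 → 𝕜)

/-- `p` is the point of intersection of the lines `(a, b)` and `(c, d)`. -/
def IsMeet (p a b c d : ProjPlane 𝕜) : Prop :=
  p.submodule = (a.submodule ⊔ b.submodule) ⊓ (c.submodule ⊔ d.submodule)

/-- `r` is the (inverse) cross ratio `[p₁, p₂, p₃, p₄]` of four points lying on one line: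
with respect to some affine parameter `t ↦ [a + t b]` of this line in which the four points
have parameters `t₁, t₂, t₃, t₄`, one has
`r = (t₁ - t₂) (t₃ - t₄) / ((t₁ - t₃) (t₂ - t₄))`.
The value does not depend on the affine parameter. -/
def IsCrossRatio (p₁ p₂ p₃ p₄ : ProjPlane 𝕜) (r : 𝕜) : Prop :=
  ∃ (a b : Fin 3 → 𝕜) (t₁ t₂ t₃ t₄ : 𝕜), LinearIndependent 𝕜 ![a, b] ∧
    p₁.submodule = Submodule.span 𝕜 {a + t₁ • b} ∧
    p₂.submodule = Submodule.span 𝕜 {a + t₂ • b} ∧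
    p₃.submodule = Submodule.span 𝕜 {a + t₃ • b} ∧
    p₄.submodule = Submodule.span 𝕜 {a + t₄ • b} ∧
    t₁ ≠ t₃ ∧ t₂ ≠ t₄ ∧
    r = ((t₁ - t₂) * (t₃ - t₄)) / ((t₁ - t₃) * (t₂ - t₄))

/-- A closed `n`-gon, as an `n`-periodic sequence of points (a twisted `n`-gon
with trivial monodromy). -/
def IsClosedPolygon (n : ℕ) (v : ℤ → ProjPlane 𝕜) : Prop :=
  ∀ i : ℤ, v (i + n) = v i

/-- Any four consecutive vertices are in general position: no three of them are collinear.
This is exactly the condition for all the corner invariants to be defined, finite and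
nonzero. -/
def IsGeneric (v : ℤ → ProjPlane 𝕜) : Prop :=
  ∀ i : ℤ,
    Projectivization.Independent ![v i, v (i + 1), v (i + 2)] ∧
    Projectivization.Independent ![v i, v (i + 1), v (i + 3)] ∧
    Projectivization.Independent ![v i, v (i + 2), v (i + 3)] ∧
    Projectivization.Independent ![v (i + 1), v (i + 2), v (i + 3)]

/-- `x = (x_1, …, x_{2n})`, with indices read modulo `2n`, is the family of corner
invariants of the polygon `v`. -/
def HasCornerInvariants (n : ℕ) (v : ℤ → ProjPlane 𝕜) (x : ZMod (2 * n) → 𝕜) : Prop :=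
  ∀ i : ℤ,
    (∃ p q : ProjPlane 𝕜,
      IsMeet p (v (i - 2)) (v (i - 1)) (v i) (v (i + 1)) ∧
      IsMeet q (v (i - 2)) (v (i - 1)) (v (i + 1)) (v (i + 2)) ∧
      IsCrossRatio (v (i - 2)) (v (i - 1)) p q (x ((2 * i - 1 : ℤ) : ZMod (2 * n)))) ∧
    (∃ p q : ProjPlane 𝕜,
      IsMeet p (v (i + 2)) (v (i + 1)) (v i) (v (i - 1)) ∧
      IsMeet q (v (i + 2)) (v (i + 1)) (v (i - 1)) (v (i - 2)) ∧
      IsCrossRatio (v (i + 2)) (v (i + 1)) p q (x ((2 * i : ℤ) : ZMod (2 * n))))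

/-- The space `𝒞_n` of closed `n`-gons, as a subset of the coordinate space `𝕜^{2n}` of the
corner invariants (the coordinates on the space of twisted `n`-gons). -/
def closedPolygonLocus (𝕜 : Type*) [RCLike 𝕜] (n : ℕ) : Set (ZMod (2 * n) → 𝕜) :=
  {x | ∃ v : ℤ → ProjPlane 𝕜,
    IsClosedPolygon n v ∧ IsGeneric v ∧ HasCornerInvariants n v x}

end Geometry

/-! ### The monodromy invariants, as polynomials in `x_1, …, x_{2n}` -/

section Invariants

open Classical in
/-- The sign `(-1)^i` for an index `i` modulo `2n`. -/
def indexSign (n : ℕ) (i : ZMod (2 * n)) : ℤ := if Even i then 1 else -1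

/-- The Poisson bracket on polynomials in `x_1, …, x_{2n}` given on coordinates by
`{x_i, x_{i+2}} = (-1)^i x_i x_{i+2}`, all other brackets of coordinates being zero. -/
def poissonBracket (n : ℕ) [NeZero n] (f g : MvPolynomial (ZMod (2 * n)) ℤ) :
    MvPolynomial (ZMod (2 * n)) ℤ :=
  ∑ i : ZMod (2 * n), C (indexSign n i) * X i * X (i + 2) *
    (pderiv i f * pderiv (i + 2) g - pderiv (i + 2) f * pderiv i g)

/-- The elementary monomial `X_i = x_{i-1} x_i x_{i+1}`. -/
def elemMonomial (n : ℕ) (i : ZMod (2 * n)) : MvPolynomial (ZMod (2 * n)) ℤ :=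
  X (i - 1) * X i * X (i + 1)

/-- The monomial `∏_{i ∈ A} X_i · ∏_{j ∈ B} x_j` is admissible: the Poisson brackets of
all the elementary monomials entering it vanish. -/
def IsAdmissible (n : ℕ) [NeZero n] (A B : Finset (ZMod (2 * n))) : Prop :=
  (∀ i ∈ A, ∀ j ∈ A, poissonBracket n (elemMonomial n i) (elemMonomial n j) = 0) ∧
  (∀ i ∈ A, ∀ j ∈ B, poissonBracket n (elemMonomial n i) (X j) = 0) ∧
  (∀ i ∈ B, ∀ j ∈ B, poissonBracket n (X i) (X j) = 0)

open Classical in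
/-- The alternating sum, with sign `(-1)^{|B|}`, of all the admissible monomials
`∏_{i ∈ A} X_i · ∏_{j ∈ B} x_j` with `|A| + |B| = k`, where the indices in `A` have the
parity prescribed by `P` and those in `B` have the opposite parity. -/
def admissibleSum (n : ℕ) [NeZero n] (P : ZMod (2 * n) → Prop) (k : ℕ) :
    MvPolynomial (ZMod (2 * n)) ℤ :=
  ∑ S : Finset (ZMod (2 * n)) × Finset (ZMod (2 * n)) with
      (∀ i ∈ S.1, P i) ∧ (∀ j ∈ S.2, ¬ P j) ∧ S.1.card + S.2.card = k ∧
        IsAdmissible n S.1 S.2,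
    (-1) ^ S.2.card * ((∏ i ∈ S.1, elemMonomial n i) * ∏ j ∈ S.2, X j)

/-- The polynomial `O_k` for `0 ≤ k ≤ n / 2` (so `O_0 = 1`). -/
def polyO (n : ℕ) [NeZero n] (k : ℕ) : MvPolynomial (ZMod (2 * n)) ℤ :=
  admissibleSum n (fun i => Even i) k

/-- The polynomial `E_k` for `0 ≤ k ≤ n / 2` (so `E_0 = 1`). -/
def polyE (n : ℕ) [NeZero n] (k : ℕ) : MvPolynomial (ZMod (2 * n)) ℤ :=
  admissibleSum n (fun i => ¬ Even i) k

open Classical in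
/-- The Casimir `O_n = x_1 x_3 ⋯ x_{2n-1}`. -/
def polyOTop (n : ℕ) [NeZero n] : MvPolynomial (ZMod (2 * n)) ℤ :=
  ∏ i : ZMod (2 * n) with ¬ Even i, X i

open Classical in
/-- The Casimir `E_n = x_2 x_4 ⋯ x_{2n}`. -/
def polyETop (n : ℕ) [NeZero n] : MvPolynomial (ZMod (2 * n)) ℤ :=
  ∏ i : ZMod (2 * n) with Even i, X i

/-- The function `O_k` on the coordinate space. -/
def invO (𝕜 : Type*) [RCLike 𝕜] (n : ℕ) [NeZero n] (k : ℕ) (x : ZMod (2 * n) → 𝕜) : 𝕜 :=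
  aeval x (polyO n k)

/-- The function `E_k` on the coordinate space. -/
def invE (𝕜 : Type*) [RCLike 𝕜] (n : ℕ) [NeZero n] (k : ℕ) (x : ZMod (2 * n) → 𝕜) : 𝕜 :=
  aeval x (polyE n k)

/-- The function `O_n` on the coordinate space. -/
def invOTop (𝕜 : Type*) [RCLike 𝕜] (n : ℕ) [NeZero n] (x : ZMod (2 * n) → 𝕜) : 𝕜 :=
  aeval x (polyOTop n)

/-- The function `E_n` on the coordinate space. -/
def invETop (𝕜 : Type*) [RCLike 𝕜] (n : ℕ) [NeZero n] (x : ZMod (2 * n) → 𝕜) : 𝕜 :=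
  aeval x (polyETop n)

end Invariants

end

/-! Let M be the product over one period of the matrices `transferMatrix a b` with a = x_{2i}, b =
x_{2i-1}. Expanded over closed walks, tr M is a partition function whose configurations are exactly
the admissible monomials, so tr M = ∑ E_k (`trace_monodromy`). The adjugate of one factor is, up to
relabelling the states, a times the same matrix with a and b exchanged, and adjugates reverse
products; hence tr adj M = E_n ∑ O_k (`trace_adjugate_monodromy`). Moreover det M = E_n² O_n.

The same matrices transport a frame built from rescaled lifts of the vertices. The lifts of a closed
polygon can be taken periodic, so after one period the frame returns to a multiple of itself, and M
= c·1 at the corner invariants (`monodromy_scalar`). Therefore ∑ E_k = 3c, E_n ∑ O_k = 3c² and E_n²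
O_n = c³. With o a cube root of O_n and e = E_n o / c one gets e³ = E_n and c = e² o.

The remaining identities express that M - c vanishes at the point. Let I be the ideal of polynomials
vanishing there. Then tr adj(M - c) ∈ I² and det(M - c) ∈ I³, which gives combinations G₁, G₂ ∈ I²
and F = det(c - M) ∈ I³ of det M, tr M and tr adj M (`Matrix.invariants_of_congr_scalar`). The
derivation ξ = ∑ (-1)^k x_k ∂_k lowers powers of I by one and multiplies E_k, O_k, E_n, O_n by k,
-k, n, -n; this is the source of the weights j and j². The vanishing of ξG₁, ξG₂ and ξ²F at the
point gives the weighted value identities, and that of dG₁, dG₂ and d(ξF) the three identities of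
differentials (`relations_at_point`). -/

/-! ### Transfer matrices -/

section Transfer

variable {R : Type*} [CommRing R]

/-- The transfer matrix of the run model. -/
def transferMatrix (a b : R) : Matrix (Fin 3) (Fin 3) R :=
  !![1, -a, a; 1, 0, 0; 0, a * b, 0]

/-- The ordered product `T 0 * T 1 * ⋯ * T (k - 1)`. -/
def orderedProd {S : Type*} [Monoid S] (T : ℕ → S) (k : ℕ) : S :=
  ((List.range k).map T).prod

@[simp] lemma orderedProd_zero {S : Type*} [Monoid S] (T : ℕ → S) : orderedProd T 0 = 1 := by
  simp [orderedProd]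

lemma orderedProd_succ {S : Type*} [Monoid S] (T : ℕ → S) (k : ℕ) :
    orderedProd T (k + 1) = orderedProd T k * T k := by
  simp [orderedProd, List.range_succ]

lemma sum_fin_succ_fun {κ M : Type*} [Fintype κ] [DecidableEq κ] [AddCommMonoid M] (k : ℕ)
    (f : (Fin (k + 1) → κ) → M) :
    ∑ s, f s = ∑ j : κ, ∑ s : Fin k → κ, f (Fin.snoc (α := fun _ => κ) s j) := by
  rw [← (Fin.snocEquiv (fun _ : Fin (k + 1) => κ)).sum_comp, Fintype.sum_prod_type]
  rfl

lemma orderedProd_apply {κ : Type*} [Fintype κ] [DecidableEq κ] (T : ℕ → Matrix κ κ R) (k : ℕ)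
    (i j : κ) :
    orderedProd T k i j = ∑ s : Fin (k + 1) → κ,
      if s (Fin.last k) = j then if s 0 = i then
        ∏ l : Fin k, T l (s l.castSucc) (s l.succ) else 0 else 0 := by
  induction k generalizing j with
  | zero =>
    rw [← (Equiv.funUnique (Fin 1) κ).symm.sum_comp]
    simp [Matrix.one_apply, eq_comm]
  | succ k ih =>
    have h0 (s : Fin (k + 1) → κ) (b : κ) :
        (Fin.snoc (α := fun _ => κ) s b : Fin (k + 2) → κ) 0 = s 0 :=
      Fin.snoc_castSucc (α := fun _ : Fin (k + 2) => κ) b s 0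
    have hl (s : Fin (k + 1) → κ) (b : κ) :
        (Fin.snoc (α := fun _ => κ) s b : Fin (k + 2) → κ) (Fin.last k).succ = b :=
      Fin.snoc_last (α := fun _ : Fin (k + 2) => κ) b s
    have hl' (s : Fin (k + 1) → κ) (b : κ) :
        (Fin.snoc (α := fun _ => κ) s b : Fin (k + 2) → κ) (Fin.last (k + 1)) = b :=
      Fin.snoc_last (α := fun _ : Fin (k + 2) => κ) b s
    have hc (s : Fin (k + 1) → κ) (b : κ) (l : Fin (k + 1)) :
        (Fin.snoc (α := fun _ => κ) s b : Fin (k + 2) → κ) l.castSucc = s l :=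
      Fin.snoc_castSucc (α := fun _ : Fin (k + 2) => κ) b s l
    rw [orderedProd_succ, Matrix.mul_apply, sum_fin_succ_fun]
    simp only [hl', h0, Fin.prod_univ_castSucc (n := k), hc, hl, ← Fin.castSucc_succ,
      Finset.sum_ite_irrel, Finset.sum_const_zero, Finset.sum_ite_eq', Finset.mem_univ, if_true,
      ih, Finset.sum_mul]
    rw [Finset.sum_comm]
    refine Finset.sum_congr rfl fun s _ => ?_
    simp [ite_mul]

/-- Expansion over closed walks: indexing by `ZMod n` lets the last transition return to the
starting state. -/
lemma trace_orderedProd {κ : Type*} [Fintype κ] [DecidableEq κ] (T : ℕ → Matrix κ κ R) (n : ℕ)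
    [NeZero n] :
    (orderedProd T n).trace = ∑ s : ZMod n → κ, ∏ l : ZMod n, T l.val (s l) (s (l + 1)) := by
  obtain ⟨m, rfl⟩ := Nat.exists_eq_succ_of_ne_zero (NeZero.ne n)
  change _ = ∑ s : Fin (m + 1) → κ, ∏ l : Fin (m + 1), T l.val (s l) (s (l + 1))
  simp only [orderedProd_succ, Matrix.trace, Matrix.diag_apply, Matrix.mul_apply,
    orderedProd_apply, Finset.sum_mul]
  simp only [Finset.sum_comm (t := (Finset.univ : Finset (Fin (m + 1) → κ)))]
  refine Finset.sum_congr rfl fun s _ => ?_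
  simp only [ite_mul, zero_mul, Finset.sum_ite_eq, Finset.mem_univ, if_true]
  rw [Fin.prod_univ_castSucc]
  simp

end Transfer

/-! ### Runs of length one and two on a cycle -/

section Runs

/-- `A` is the set of last positions of the runs of length two, and `B` the set of positions of
the runs of length one, in a subset of the cycle `ℤ/n` without longer runs. -/
def IsRunPair {n : ℕ} (A B : Finset (ZMod n)) : Prop :=
  (∀ i ∈ A, i + 1 ∉ A ∧ i + 2 ∉ A ∧ i - 2 ∉ B ∧ i - 1 ∉ B ∧ i ∉ B ∧ i + 1 ∉ B) ∧
    ∀ i ∈ B, i + 1 ∉ B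

/-- Runs are separated, so the set of last positions of all runs is disjoint from its translate by
1. -/
lemma IsRunPair.two_mul_card_le {n : ℕ} [NeZero n] {A B : Finset (ZMod n)} (h : IsRunPair A B) :
    2 * (A.card + B.card) ≤ n := by
  have h1 : Disjoint A B := Finset.disjoint_left.2 fun i hi => (h.1 i hi).2.2.2.2.1
  have h2 : Disjoint (A ∪ B) ((A ∪ B).map (addRightEmbedding 1)) := by
    rw [Finset.disjoint_right]
    intro j hj
    obtain ⟨i, hi, rfl⟩ := Finset.mem_map.1 hj
    simp only [addRightEmbedding_apply, Finset.mem_union] at hi ⊢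
    rintro (h' | h') <;> rcases hi with hi | hi
    · exact (h.1 i hi).1 h'
    · have := (h.1 _ h').2.2.2.1
      simp_all
    · exact (h.1 i hi).2.2.2.2.2 h'
    · exact h.2 i hi h'
  have := Finset.card_le_univ ((A ∪ B) ∪ ((A ∪ B).map (addRightEmbedding 1)))
  rw [Finset.card_union_of_disjoint h2, Finset.card_map, Finset.card_union_of_disjoint h1,
    ZMod.card] at this
  omega

/-- The transitions of the run model. -/
def IsStep : Fin 3 → Fin 3 → Prop
  | 0, _ => True
  | 1, j => j = 0
  | 2, j => j = 1

lemma transferMatrix_eq_zero {R : Type*} [CommRing R] (a b : R) {i j : Fin 3} (h : ¬ IsStep i j) :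
    transferMatrix a b i j = 0 := by
  fin_cases i <;> fin_cases j <;> simp [IsStep, transferMatrix] at h ⊢

open Classical in
/-- The state sequence of a run pair. -/
def runState {n : ℕ} (A B : Finset (ZMod n)) (i : ZMod n) : Fin 3 :=
  if i ∈ A then 2 else if i - 1 ∈ A ∨ i - 1 ∈ B then 1 else 0

lemma isStep_runState {n : ℕ} {A B : Finset (ZMod n)} (h : IsRunPair A B) (i : ZMod n) :
    IsStep (runState A B i) (runState A B (i + 1)) := by
  by_cases h1 : i ∈ A
  · have := h.1 i h1
    simp [runState, h1, this, IsStep]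
  by_cases h2 : i - 1 ∈ A ∨ i - 1 ∈ B
  · have e : runState A B i = 1 := by simp [runState, h1, h2]
    have h3 : i + 1 ∉ A ∧ i ∉ B := by
      rcases h2 with h2 | h2
      · have := h.1 _ h2
        rw [show i - 1 + 2 = i + 1 by ring, show i - 1 + 1 = i by ring] at this
        tauto
      · have := h.2 _ h2
        rw [show i - 1 + 1 = i by ring] at this
        refine ⟨fun h' => ?_, this⟩
        have := h.1 _ h'
        rw [show i + 1 - 2 = i - 1 by ring] at this
        tauto
    rw [e]
    simp [IsStep, runState, h3, h1]
  · have e : runState A B i = 0 := by simp [runState, h1, h2]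
    rw [e]
    trivial

/-- State 2 is entered only from 0 and is followed by 1, then 0. The states at i - 1, i, i + 1, i +
2 around a position i in state 2 are thus 0, 2, 1, 0, which yields every exclusion. -/
lemma isRunPair_of_isStep {n : ℕ} [NeZero n] {s : ZMod n → Fin 3}
    (hs : ∀ i, IsStep (s i) (s (i + 1))) :
    IsRunPair ({i | s i = 2} : Finset (ZMod n)) {i | s i = 0 ∧ s (i + 1) = 1} := by
  have h2 (i : ZMod n) (hi : s i = 2) : s (i + 1) = 1 := by simpa [IsStep, hi] using hs i
  have h1 (i : ZMod n) (hi : s i = 1) : s (i + 1) = 0 := by simpa [IsStep, hi] using hs i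
  constructor
  · intro i hi
    simp only [Finset.mem_filter, Finset.mem_univ, true_and] at hi ⊢
    have k1 := h2 _ hi
    have k2 := h1 _ k1
    rw [show i + 1 + 1 = i + 2 by ring] at k2
    rw [show i - 2 + 1 = i - 1 by ring, show i - 1 + 1 = i by ring,
      show i + 1 + 1 = i + 2 by ring]
    have k3 : s (i - 1) ≠ 1 := fun h => by
      have := h1 _ h
      rw [show i - 1 + 1 = i by ring, hi] at this
      exact absurd this (by decide)
    simp [hi, k1, k2, k3]
  · intro i hi
    simp only [Finset.mem_filter, Finset.mem_univ, true_and] at hi ⊢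
    simp [hi]

lemma runState_of_isStep {n : ℕ} [NeZero n] {s : ZMod n → Fin 3}
    (hs : ∀ i, IsStep (s i) (s (i + 1))) :
    runState ({i | s i = 2} : Finset (ZMod n)) {i | s i = 0 ∧ s (i + 1) = 1} = s := by
  funext i
  have h := hs (i - 1)
  rw [show i - 1 + 1 = i by ring] at h
  simp only [runState, Finset.mem_filter, Finset.mem_univ, true_and,
    show i - 1 + 1 = i by ring]
  generalize s i = u at h ⊢
  generalize s (i - 1) = w at h ⊢
  fin_cases u <;> fin_cases w <;> simp [IsStep] at h ⊢

lemma filter_runState_eq_two {n : ℕ} [NeZero n] (A B : Finset (ZMod n)) :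
    ({i | runState A B i = 2} : Finset (ZMod n)) = A := by
  ext i
  rw [Finset.mem_filter, runState]
  split_ifs <;> simp_all

lemma filter_runState_eq_zero_one {n : ℕ} [NeZero n] {A B : Finset (ZMod n)} (h : IsRunPair A B) :
    ({i | runState A B i = 0 ∧ runState A B (i + 1) = 1} : Finset (ZMod n)) = B := by
  ext i
  simp only [Finset.mem_filter, Finset.mem_univ, true_and]
  constructor
  · rintro ⟨h0, h1⟩
    simp only [runState, add_sub_cancel_right] at h0 h1
    by_cases hA : i ∈ A
    · simp [hA] at h0
    · by_contra hB
      simp only [hA, hB, or_self, if_false] at h1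
      split_ifs at h1 <;> simp at h1
  · intro hi
    have hA : i ∉ A := fun h' => (h.1 i h').2.2.2.2.1 hi
    have hA1 : i + 1 ∉ A := fun h' => (h.1 _ h').2.2.2.1 (by simpa using hi)
    have hA2 : i - 1 ∉ A := fun h' => (h.1 _ h').2.2.2.2.2 (by simpa using hi)
    have hB2 : i - 1 ∉ B := fun h' => h.2 _ h' (by simpa using hi)
    simp [runState, hA, hA1, hA2, hB2, hi]

open Classical in
lemma prod_transferMatrix {R : Type*} [CommRing R] {n : ℕ} [NeZero n] (a b : ZMod n → R)
    {s : ZMod n → Fin 3} (hs : ∀ i, IsStep (s i) (s (i + 1))) :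
    ∏ i, transferMatrix (a i) (b i) (s i) (s (i + 1)) =
      (∏ i with s i = 2, a (i - 1) * b i * a i) * ∏ i with s i = 0 ∧ s (i + 1) = 1, -a i := by
  -- A run of length two takes its weight from two transitions: a on 0 → 2 and a·b on 2 → 1. The
  -- first belongs to the position before the one in state 2, hence the shift to `a (i - 1)`
  -- afterwards.
  have key : ∀ i, transferMatrix (a i) (b i) (s i) (s (i + 1)) =
      (if s i = 2 then b i * a i else 1) * (if s (i + 1) = 2 then a i else 1) *
        (if s i = 0 ∧ s (i + 1) = 1 then -a i else 1) := by
    intro i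
    have h := hs i
    generalize s i = u at h ⊢
    generalize s (i + 1) = w at h ⊢
    fin_cases u <;> fin_cases w <;> simp [IsStep, transferMatrix, mul_comm] at h ⊢
  simp only [key, Finset.prod_mul_distrib, ← Finset.prod_filter]
  congr 1
  have : ∏ i with s (i + 1) = 2, a i = ∏ i with s i = 2, a (i - 1) := by
    simp only [Finset.prod_filter]
    rw [← Equiv.prod_comp (Equiv.addRight (1 : ZMod n)) (fun i => if s i = 2 then a (i - 1) else 1)]
    simp
  rw [this]
  ring

open Classical in
/-- The trace of a product of transfer matrices is the partition function of the run model. -/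
theorem trace_orderedProd_transferMatrix {R : Type*} [CommRing R] {n : ℕ} [NeZero n]
    (a b : ZMod n → R) :
    (orderedProd (fun i => transferMatrix (a i) (b i)) n).trace =
      ∑ S : Finset (ZMod n) × Finset (ZMod n) with IsRunPair S.1 S.2,
        (∏ i ∈ S.1, a (i - 1) * b i * a i) * ∏ i ∈ S.2, -a i := by
  rw [trace_orderedProd]
  simp only [ZMod.natCast_val, ZMod.cast_id', id_eq]
  have h0 : ∀ s : ZMod n → Fin 3, (∏ i, transferMatrix (a i) (b i) (s i) (s (i + 1))) ≠ 0 →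
      ∀ i, IsStep (s i) (s (i + 1)) := by
    intro s h i
    by_contra h'
    exact h (Finset.prod_eq_zero (Finset.mem_univ i) (transferMatrix_eq_zero _ _ h'))
  rw [← Finset.sum_filter_of_ne (p := fun s => ∀ i, IsStep (s i) (s (i + 1)))
    (fun s _ h => h0 s h)]
  refine Finset.sum_bij' (fun s _ => (({i | s i = 2} : Finset (ZMod n)),
      ({i | s i = 0 ∧ s (i + 1) = 1} : Finset (ZMod n)))) (fun S _ => runState S.1 S.2) ?_ ?_ ?_ ?_ ?_
  · intro s hs
    simp only [Finset.mem_filter, Finset.mem_univ, true_and] at hs ⊢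
    convert isRunPair_of_isStep hs
  · intro S hS
    simp only [Finset.mem_filter, Finset.mem_univ, true_and] at hS ⊢
    exact isStep_runState hS
  · intro s hs
    simp only [Finset.mem_filter, Finset.mem_univ, true_and] at hs
    convert runState_of_isStep hs
  · intro S hS
    simp only [Finset.mem_filter, Finset.mem_univ, true_and] at hS
    ext1
    · convert filter_runState_eq_two S.1 S.2
    · convert filter_runState_eq_zero_one hS
  · intro s hs
    simp only [Finset.mem_filter, Finset.mem_univ, true_and] at hs
    convert prod_transferMatrix a b hs

end Runs

/-! ### Determinant and adjugate of a product of transfer matrices -/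

section Adjugate

variable {R : Type*} [CommRing R]

lemma orderedProd_succ' {S : Type*} [Monoid S] (T : ℕ → S) (k : ℕ) :
    orderedProd T (k + 1) = T 0 * orderedProd (fun i => T (i + 1)) k := by
  simp [orderedProd, List.range_succ_eq_map, Function.comp_def]

lemma orderedProd_congr {S : Type*} [Monoid S] {T U : ℕ → S} {k : ℕ} (h : ∀ i < k, T i = U i) :
    orderedProd T k = orderedProd U k := by
  unfold orderedProd
  congr 1
  exact List.map_congr_left fun i hi => h i (List.mem_range.1 hi)

lemma map_orderedProd {S S' F : Type*} [Monoid S] [Monoid S'] [FunLike F S S']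
    [MonoidHomClass F S S'] (f : F) (T : ℕ → S) (k : ℕ) :
    f (orderedProd T k) = orderedProd (fun i => f (T i)) k := by
  simp [orderedProd, map_list_prod, Function.comp_def]

lemma prod_range_eq_prod_zmod {M : Type*} [CommMonoid M] {n : ℕ} [NeZero n] (f : ZMod n → M) :
    ∏ i ∈ Finset.range n, f i = ∏ i : ZMod n, f i := by
  obtain ⟨m, rfl⟩ := Nat.exists_eq_succ_of_ne_zero (NeZero.ne n)
  rw [Finset.prod_range]
  change ∏ i : Fin (m + 1), f ((i.val : ℕ) : ZMod (m + 1)) = ∏ i : Fin (m + 1), f i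
  refine Finset.prod_congr rfl fun i _ => ?_
  congr 1
  exact ZMod.natCast_zmod_val (n := m + 1) i

lemma orderedProd_eq_prod {S : Type*} [CommMonoid S] (T : ℕ → S) (k : ℕ) :
    orderedProd T k = ∏ i ∈ Finset.range k, T i := by
  induction k with
  | zero => simp
  | succ k ih => rw [orderedProd_succ, ih, Finset.prod_range_succ]

lemma det_orderedProd_transferMatrix {n : ℕ} [NeZero n] (a b : ZMod n → R) :
    (orderedProd (fun i => transferMatrix (a i) (b i)) n).det = (∏ i, a i) ^ 2 * ∏ i, b i := by
  rw [← Matrix.coe_detMonoidHom, map_orderedProd, orderedProd_eq_prod]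
  have (i : ℕ) : Matrix.detMonoidHom (transferMatrix (a i) (b i)) = a i ^ 2 * b i := by
    simp [transferMatrix, Matrix.det_fin_three]
    ring
  simp only [this]
  rw [prod_range_eq_prod_zmod (fun i => a i ^ 2 * b i), Finset.prod_mul_distrib, Finset.prod_pow]

lemma adjugate_orderedProd {κ : Type*} [Fintype κ] [DecidableEq κ] (T : ℕ → Matrix κ κ R) (k : ℕ) :
    (orderedProd T k).adjugate = orderedProd (fun i => (T (k - 1 - i)).adjugate) k := by
  induction k with
  | zero => simp
  | succ k ih =>
    rw [orderedProd_succ, Matrix.adjugate_mul_distrib, ih, orderedProd_succ']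
    congr 1
    refine orderedProd_congr fun i _ => ?_
    congr 2
    omega

/-- This is the symmetry between the E and the O invariants: the adjugate exchanges the two kinds of
corner invariants, once the states 0 and 2 are swapped. -/
lemma adjugate_transferMatrix (a b : R) :
    (transferMatrix a b).adjugate =
      a • Matrix.reindexAlgEquiv R R (Equiv.swap (0 : Fin 3) 2) (transferMatrix b a) := by
  have h0 : Equiv.swap (0 : Fin 3) 2 0 = 2 := by decide
  have h1 : Equiv.swap (0 : Fin 3) 2 1 = 1 := by decide
  have h2 : Equiv.swap (0 : Fin 3) 2 2 = 0 := by decide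
  ext i j
  fin_cases i <;> fin_cases j <;>
    simp [transferMatrix, Matrix.adjugate_fin_three_of, h0, h1, h2, mul_comm]

lemma orderedProd_smul {κ : Type*} [Fintype κ] [DecidableEq κ] (c : ℕ → R)
    (T : ℕ → Matrix κ κ R) (k : ℕ) :
    orderedProd (fun i => c i • T i) k = (∏ i ∈ Finset.range k, c i) • orderedProd T k := by
  induction k with
  | zero => simp
  | succ k ih =>
    rw [orderedProd_succ, ih, orderedProd_succ, Finset.prod_range_succ, smul_mul_smul_comm]

lemma trace_reindexAlgEquiv {κ : Type*} [Fintype κ] [DecidableEq κ] (σ : Equiv.Perm κ)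
    (M : Matrix κ κ R) : (Matrix.reindexAlgEquiv R R σ M).trace = M.trace := by
  simp only [Matrix.trace, Matrix.diag_apply, Matrix.coe_reindexAlgEquiv, Matrix.reindex_apply,
    Matrix.submatrix_apply]
  exact σ.symm.sum_comp fun i => M i i

/-- Conjugation by the swap does not affect the trace. The reflection i ↦ -1 - i records that the
adjugate reverses the order of the factors. -/
lemma trace_adjugate_orderedProd_transferMatrix {n : ℕ} [NeZero n] (a b : ZMod n → R) :
    (orderedProd (fun i => transferMatrix (a i) (b i)) n).adjugate.trace =
      (∏ i, a i) *
        (orderedProd (fun i => transferMatrix (b (-1 - i)) (a (-1 - i))) n).trace := by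
  rw [adjugate_orderedProd]
  have : ∀ i < n, (transferMatrix (a ((n - 1 - i : ℕ) : ZMod n))
        (b ((n - 1 - i : ℕ) : ZMod n))).adjugate =
      a (-1 - i) • Matrix.reindexAlgEquiv R R (Equiv.swap (0 : Fin 3) 2)
        (transferMatrix (b (-1 - i)) (a (-1 - i))) := by
    intro i hi
    have : ((n - 1 - i : ℕ) : ZMod n) = -1 - i := by
      rw [Nat.cast_sub (by omega), Nat.cast_sub (by omega)]
      simp
    rw [this, adjugate_transferMatrix]
  rw [orderedProd_congr this, orderedProd_smul, ← map_orderedProd, Matrix.trace_smul,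
    trace_reindexAlgEquiv, smul_eq_mul, prod_range_eq_prod_zmod (fun i => a (-1 - i))]
  congr 1
  exact (Equiv.subLeft (-1 : ZMod n)).prod_comp a

end Adjugate

/-! ### Poisson brackets of elementary monomials -/

section Brackets

variable {n : ℕ}

/-- `f` behaves under `x_k ∂_k` like a monomial with exponents `u`. -/
def HasExponents (u : ZMod (2 * n) → ℤ) (f : MvPolynomial (ZMod (2 * n)) ℤ) : Prop :=
  ∀ k, X k * pderiv k f = C (u k) * f

lemma hasExponents_X (j : ZMod (2 * n)) : HasExponents (Pi.single j 1) (X j) := by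
  intro k
  rw [pderiv_X]
  rcases eq_or_ne k j with rfl | h
  · simp
  · simp [h, h.symm]

lemma HasExponents.mul {u w : ZMod (2 * n) → ℤ} {f g : MvPolynomial (ZMod (2 * n)) ℤ}
    (hf : HasExponents u f) (hg : HasExponents w g) : HasExponents (u + w) (f * g) := by
  intro k
  rw [Derivation.leibniz, Pi.add_apply, C_add, smul_eq_mul, smul_eq_mul]
  linear_combination f * hg k + g * hf k

lemma hasExponents_elemMonomial (j : ZMod (2 * n)) :
    HasExponents (Pi.single (j - 1) 1 + Pi.single j 1 + Pi.single (j + 1) 1) (elemMonomial n j) :=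
  ((hasExponents_X _).mul (hasExponents_X _)).mul (hasExponents_X _)

/-- The Poisson form on exponents. -/
noncomputable def poissonForm [NeZero n] (u w : ZMod (2 * n) → ℤ) : ℤ :=
  ∑ k, indexSign n k * (u k * w (k + 2) - u (k + 2) * w k)

/-- The bracket is log-canonical: on monomials it is multiplication by an integer bilinear form in
the exponents, so commutation becomes a linear condition. -/
lemma poissonBracket_eq [NeZero n] {u w : ZMod (2 * n) → ℤ} {f g : MvPolynomial (ZMod (2 * n)) ℤ}
    (hf : HasExponents u f) (hg : HasExponents w g) :
    poissonBracket n f g = C (poissonForm u w) * (f * g) := by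
  rw [poissonBracket, poissonForm, map_sum, Finset.sum_mul]
  refine Finset.sum_congr rfl fun k _ => ?_
  simp only [C_mul, C_sub]
  linear_combination C (indexSign n k) * (X (k + 2) * pderiv (k + 2) g * hf k +
    C (u k) * f * hg (k + 2) - X (k + 2) * pderiv (k + 2) f * hg k - C (w k) * g * hf (k + 2))

/-- Parity survives reduction because the modulus 2n is even. -/
lemma even_intCast (m : ℤ) : Even ((m : ℤ) : ZMod (2 * n)) ↔ Even m := by
  constructor
  · rintro ⟨r, hr⟩
    obtain ⟨r, rfl⟩ := ZMod.intCast_surjective r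
    rw [← Int.cast_add, ZMod.intCast_eq_intCast_iff_dvd_sub] at hr
    obtain ⟨c, hc⟩ := hr
    rw [Int.even_iff]
    push_cast at hc
    have : m = 2 * (r - n * c) := by linarith
    omega
  · intro h
    exact h.map (Int.castRingHom (ZMod (2 * n)))

lemma not_even_iff (j : ZMod (2 * n)) : ¬ Even j ↔ Even (j + 1) := by
  obtain ⟨m, rfl⟩ := ZMod.intCast_surjective j
  rw [even_intCast, ← Int.cast_one, ← Int.cast_add, even_intCast, Int.even_add_one]

lemma indexSign_add_one (j : ZMod (2 * n)) : indexSign n (j + 1) = - indexSign n j := by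
  unfold indexSign
  by_cases h : Even j
  · have : ¬ Even (j + 1) := fun h' => (not_even_iff j).2 h' h
    simp [h, this]
  · simp [h, (not_even_iff j).1 h]

lemma indexSign_add_two (j : ZMod (2 * n)) : indexSign n (j + 2) = indexSign n j := by
  rw [show j + 2 = j + 1 + 1 by ring, indexSign_add_one, indexSign_add_one, neg_neg]

lemma indexSign_ne_zero (j : ZMod (2 * n)) : indexSign n j ≠ 0 := by
  unfold indexSign
  split_ifs <;> simp

lemma poissonForm_add [NeZero n] (u u' w : ZMod (2 * n) → ℤ) :
    poissonForm (u + u') w = poissonForm u w + poissonForm u' w := by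
  simp only [poissonForm, ← Finset.sum_add_distrib, Pi.add_apply]
  exact Finset.sum_congr rfl fun k _ => by ring

lemma poissonForm_single [NeZero n] (p : ZMod (2 * n)) (w : ZMod (2 * n) → ℤ) :
    poissonForm (Pi.single p 1) w = indexSign n p * (w (p + 2) - w (p - 2)) := by
  unfold poissonForm
  have h1 : ∑ k, indexSign n k * ((Pi.single p 1 : ZMod (2 * n) → ℤ) k * w (k + 2)) =
      indexSign n p * w (p + 2) := by
    rw [Finset.sum_eq_single p] <;> simp +contextual
  have h2 : ∑ k, indexSign n k * ((Pi.single p 1 : ZMod (2 * n) → ℤ) (k + 2) * w k) =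
      indexSign n p * w (p - 2) := by
    rw [Finset.sum_eq_single (p - 2)]
    · rw [← indexSign_add_two]; simp
    · intro b _ hb
      have : b + 2 ≠ p := fun h => hb (by rw [← h]; ring)
      simp [this]
    · simp
  simp only [mul_sub, Finset.sum_sub_distrib, h1, h2]

lemma poissonForm_elem [NeZero n] (i : ZMod (2 * n)) (w : ZMod (2 * n) → ℤ) :
    poissonForm (Pi.single (i - 1) 1 + Pi.single i 1 + Pi.single (i + 1) 1) w =
      indexSign n i * (w (i - 3) - w (i + 1) + w (i + 2) - w (i - 2) + w (i - 1) - w (i + 3)) := by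
  have h : indexSign n (i - 1) = - indexSign n i := by
    have := indexSign_add_one (n := n) (i - 1)
    rw [sub_add_cancel] at this
    rw [this, neg_neg]
  rw [poissonForm_add, poissonForm_add, poissonForm_single, poissonForm_single,
    poissonForm_single, indexSign_add_one, h, show i - 1 + 2 = i + 1 by ring,
    show i - 1 - 2 = i - 3 by ring, show i + 1 + 2 = i + 3 by ring,
    show i + 1 - 2 = i - 1 by ring]
  ring

lemma natCast_ne_zero_of_lt {m : ℕ} (hm : 0 < m) (h : m < 2 * n) : (m : ZMod (2 * n)) ≠ 0 := by
  rw [Ne, ZMod.natCast_eq_zero_iff]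
  exact fun h' => absurd (Nat.le_of_dvd hm h') (by omega)

lemma poissonBracket_eq_zero_iff [NeZero n] {u w : ZMod (2 * n) → ℤ} {f g : MvPolynomial (ZMod (2 * n)) ℤ}
    (hf : HasExponents u f) (hg : HasExponents w g) (hf0 : f ≠ 0) (hg0 : g ≠ 0) :
    poissonBracket n f g = 0 ↔ poissonForm u w = 0 := by
  rw [poissonBracket_eq hf hg]
  simp [hf0, hg0]

lemma elemMonomial_ne_zero (i : ZMod (2 * n)) : elemMonomial n i ≠ 0 := by
  simp [elemMonomial]

lemma poissonBracket_X_X [NeZero n] (hn : 5 ≤ n) (i j : ZMod (2 * n)) :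
    poissonBracket n (X i) (X j) = 0 ↔ j - i ≠ 2 ∧ j - i ≠ -2 := by
  have h4 : (4 : ZMod (2 * n)) ≠ 0 := by
    exact_mod_cast natCast_ne_zero_of_lt (n := n) (m := 4) (by omega) (by omega)
  rw [poissonBracket_eq_zero_iff (hasExponents_X i) (hasExponents_X j) (X_ne_zero i) (X_ne_zero j),
    poissonForm_single, mul_eq_zero, or_iff_right (indexSign_ne_zero i)]
  obtain ⟨d, rfl⟩ : ∃ d, j = i + d := ⟨j - i, by ring⟩
  simp only [Pi.single_apply, sub_eq_add_neg, add_right_inj,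
    add_neg_cancel_comm]
  by_cases h1 : d = 2
  · subst h1
    have : (-2 : ZMod (2 * n)) ≠ 2 := fun h => h4 (by linear_combination -h)
    simp [this]
  by_cases h2 : d = -2
  · subst h2
    have : (2 : ZMod (2 * n)) ≠ -2 := fun h => h4 (by linear_combination h)
    simp [this]
  simp [h1, h2, Ne.symm h1, Ne.symm h2]

lemma poissonBracket_elem_X [NeZero n] (hn : 5 ≤ n) (i j : ZMod (2 * n)) (hd : ¬ Even (j - i)) :
    poissonBracket n (elemMonomial n i) (X j) = 0 ↔
      j - i ≠ 1 ∧ j - i ≠ -1 ∧ j - i ≠ 3 ∧ j - i ≠ -3 := by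
  have h2 : (2 : ZMod (2 * n)) ≠ 0 := by
    exact_mod_cast natCast_ne_zero_of_lt (n := n) (m := 2) (by omega) (by omega)
  have h4 : (4 : ZMod (2 * n)) ≠ 0 := by
    exact_mod_cast natCast_ne_zero_of_lt (n := n) (m := 4) (by omega) (by omega)
  have h6 : (6 : ZMod (2 * n)) ≠ 0 := by
    exact_mod_cast natCast_ne_zero_of_lt (n := n) (m := 6) (by omega) (by omega)
  rw [poissonBracket_eq_zero_iff (hasExponents_elemMonomial i) (hasExponents_X j)
    (elemMonomial_ne_zero i) (X_ne_zero j),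
    poissonForm_elem, mul_eq_zero, or_iff_right (indexSign_ne_zero i)]
  obtain ⟨d, rfl⟩ : ∃ d, j = i + d := ⟨j - i, by ring⟩
  rw [add_sub_cancel_left] at hd ⊢
  -- Odd shifts miss the two terms of the form at i ± 2; the other four are the listed exceptions.
  have e2 : ¬ 2 = d := fun h => hd (h ▸ ⟨1, by ring⟩)
  have e2' : ¬ -2 = d := fun h => hd (h ▸ ⟨-1, by ring⟩)
  simp only [Pi.single_apply, sub_eq_add_neg, add_right_inj, e2, e2', if_false]
  by_cases k1 : d = 1
  · subst k1
    have a1 : (-3 : ZMod (2 * n)) ≠ 1 := fun h => h4 (by linear_combination -h)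
    have a2 : (-1 : ZMod (2 * n)) ≠ 1 := fun h => h2 (by linear_combination -h)
    have a3 : (3 : ZMod (2 * n)) ≠ 1 := fun h => h2 (by linear_combination h)
    simp [a1, a2, a3]
  by_cases k2 : d = -1
  · subst k2
    have a1 : (-3 : ZMod (2 * n)) ≠ -1 := fun h => h2 (by linear_combination -h)
    have a2 : (1 : ZMod (2 * n)) ≠ -1 := fun h => h2 (by linear_combination h)
    have a3 : (3 : ZMod (2 * n)) ≠ -1 := fun h => h4 (by linear_combination h)
    simp [a1, a2, a3]
  by_cases k3 : d = 3
  · subst k3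
    have a1 : (-3 : ZMod (2 * n)) ≠ 3 := fun h => h6 (by linear_combination -h)
    have a2 : (1 : ZMod (2 * n)) ≠ 3 := fun h => h2 (by linear_combination -h)
    have a3 : (-1 : ZMod (2 * n)) ≠ 3 := fun h => h4 (by linear_combination -h)
    simp [a1, a2, a3]
  by_cases k4 : d = -3
  · subst k4
    have a1 : (3 : ZMod (2 * n)) ≠ -3 := fun h => h6 (by linear_combination h)
    have a2 : (1 : ZMod (2 * n)) ≠ -3 := fun h => h4 (by linear_combination h)
    have a3 : (-1 : ZMod (2 * n)) ≠ -3 := fun h => h2 (by linear_combination h)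
    simp [a1, a2, a3]
  simp [k1, k2, k3, k4, Ne.symm k1, Ne.symm k2, Ne.symm k3, Ne.symm k4]

lemma poissonBracket_elem_elem [NeZero n] (hn : 5 ≤ n) (i j : ZMod (2 * n)) (hd : Even (j - i)) :
    poissonBracket n (elemMonomial n i) (elemMonomial n j) = 0 ↔
      j - i ≠ 2 ∧ j - i ≠ -2 ∧ j - i ≠ 4 ∧ j - i ≠ -4 := by
  have h2 : (2 : ZMod (2 * n)) ≠ 0 := by
    exact_mod_cast natCast_ne_zero_of_lt (n := n) (m := 2) (by omega) (by omega)
  have h4 : (4 : ZMod (2 * n)) ≠ 0 := by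
    exact_mod_cast natCast_ne_zero_of_lt (n := n) (m := 4) (by omega) (by omega)
  have h6 : (6 : ZMod (2 * n)) ≠ 0 := by
    exact_mod_cast natCast_ne_zero_of_lt (n := n) (m := 6) (by omega) (by omega)
  -- Here n ≥ 5 is essential: for n = 4 the shifts 4 and -4 coincide and their contributions cancel.
  have h8 : (8 : ZMod (2 * n)) ≠ 0 := by
    exact_mod_cast natCast_ne_zero_of_lt (n := n) (m := 8) (by omega) (by omega)
  rw [poissonBracket_eq_zero_iff (hasExponents_elemMonomial i) (hasExponents_elemMonomial j)
    (elemMonomial_ne_zero i) (elemMonomial_ne_zero j),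
    poissonForm_elem, mul_eq_zero, or_iff_right (indexSign_ne_zero i)]
  obtain ⟨d, rfl⟩ : ∃ d, j = i + d := ⟨j - i, by ring⟩
  rw [add_sub_cancel_left] at hd ⊢
  have odd : ∀ m : ℤ, ¬ Even m → d ≠ (m : ZMod (2 * n)) := by
    intro m hm h
    exact hm ((even_intCast (n := n) m).1 (h ▸ hd))
  have o1 : ¬ d = 1 := by simpa using odd 1 (by decide)
  have o2 : ¬ d = -1 := by simpa using odd (-1) (by decide)
  have o3 : ¬ d = 3 := by simpa using odd 3 (by decide)
  have o4 : ¬ d = -3 := by simpa using odd (-3) (by decide)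
  have c (p q r : ZMod (2 * n)) (h : r = p - q) : i + p = i + d + q ↔ d = r := by
    rw [h]
    constructor <;> intro h <;> linear_combination -h
  have c0 (p : ZMod (2 * n)) : i + p = i + d ↔ d = p := by
    rw [add_right_inj, eq_comm]
  simp only [Pi.add_apply, Pi.single_apply, sub_eq_add_neg, c0, o1, o2, o3, o4, if_false,
    c 1 1 0 (by ring), c 1 (-1) 2 (by ring), c (-1) 1 (-2) (by ring), c (-1) (-1) 0 (by ring),
    c 2 1 1 (by ring), c 2 (-1) 3 (by ring), c (-2) 1 (-3) (by ring), c (-2) (-1) (-1) (by ring),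
    c 3 1 2 (by ring), c 3 (-1) 4 (by ring), c (-3) 1 (-4) (by ring), c (-3) (-1) (-2) (by ring)]
  by_cases k1 : d = 2
  · subst k1
    have a1 : (2 : ZMod (2 * n)) ≠ -2 := fun h => h4 (by linear_combination h)
    have a2 : (2 : ZMod (2 * n)) ≠ 4 := fun h => h2 (by linear_combination -h)
    have a3 : (2 : ZMod (2 * n)) ≠ -4 := fun h => h6 (by linear_combination h)
    simp [a1, a2, a3, h2]
  by_cases k2 : d = -2
  · subst k2
    have a2 : (-2 : ZMod (2 * n)) ≠ 4 := fun h => h6 (by linear_combination -h)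
    have a3 : (-2 : ZMod (2 * n)) ≠ -4 := fun h => h2 (by linear_combination h)
    simp [k1, a2, a3, h2]
  by_cases k3 : d = 4
  · subst k3
    have a3 : (4 : ZMod (2 * n)) ≠ -4 := fun h => h8 (by linear_combination h)
    simp [k1, k2, a3, h4]
  by_cases k4 : d = -4
  · subst k4
    simp [k1, k2, k3, h4]
  simp [k1, k2, k3, k4]

end Brackets

/-! ### The monodromy invariants as traces -/

section Monodromy

variable {n : ℕ}

/-- Doubling, as a map from `ℤ/n` to `ℤ/2n`. -/
def doubling (n : ℕ) : ZMod n →+ ZMod (2 * n) :=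
  ZMod.lift n ⟨(Int.castAddHom (ZMod (2 * n))).comp (AddMonoidHom.mulLeft (2 : ℤ)), by
    have := ZMod.natCast_self (2 * n)
    push_cast at this
    simpa using this⟩

lemma doubling_intCast (m : ℤ) : doubling n m = ((2 * m : ℤ) : ZMod (2 * n)) := by
  simp [doubling]

lemma doubling_one : doubling n 1 = 2 := by
  simpa using doubling_intCast (n := n) 1

lemma doubling_injective : Function.Injective (doubling n) := by
  refine (injective_iff_map_eq_zero _).2 fun i hi => ?_
  obtain ⟨m, rfl⟩ := ZMod.intCast_surjective i
  rw [doubling_intCast, ZMod.intCast_zmod_eq_zero_iff_dvd] at hi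
  rw [ZMod.intCast_zmod_eq_zero_iff_dvd]
  push_cast at hi
  exact (mul_dvd_mul_iff_left two_ne_zero).1 hi

lemma even_iff_exists_doubling (j : ZMod (2 * n)) : Even j ↔ ∃ i, doubling n i = j := by
  constructor
  · rintro ⟨r, rfl⟩
    obtain ⟨m, rfl⟩ := ZMod.intCast_surjective r
    exact ⟨m, by rw [doubling_intCast]; push_cast; ring⟩
  · rintro ⟨i, rfl⟩
    obtain ⟨m, rfl⟩ := ZMod.intCast_surjective i
    rw [doubling_intCast, even_intCast]
    exact even_two_mul m

/-- A parity-respecting indexing of the factors of admissible monomials by `ℤ/n`: the factor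
`X_i` attached to `i` has index `φA i`, the factor `x_i` has index `φB i`. -/
structure FactorIndexing (n : ℕ) (P : ZMod (2 * n) → Prop) where
  /-- the indices of the factors `X_i` -/
  φA : ZMod n ↪ ZMod (2 * n)
  /-- the indices of the factors `x_i` -/
  φB : ZMod n ↪ ZMod (2 * n)
  /-- the orientation -/
  ε : ℤ
  ε_eq : ε = 1 ∨ ε = -1
  prop_iff : ∀ j, P j ↔ ∃ i, φA i = j
  not_prop_iff : ∀ j, ¬ P j ↔ ∃ i, φB i = j
  φA_sub : ∀ i j, φA i - φA j = ε * doubling n (i - j)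
  φB_eq : ∀ i, φB i = φA i + ε

namespace FactorIndexing

variable {P : ZMod (2 * n) → Prop}

lemma φB_sub_φA (F : FactorIndexing n P) (i j : ZMod n) :
    F.φB j - F.φA i = F.ε * (doubling n (j - i) + 1) := by
  rw [F.φB_eq, add_sub_right_comm, F.φA_sub]
  ring

lemma φB_sub (F : FactorIndexing n P) (i j : ZMod n) :
    F.φB j - F.φB i = F.ε * doubling n (j - i) := by
  rw [F.φB_eq, F.φB_eq, add_sub_add_right_eq_sub, F.φA_sub]

lemma sign_mul_doubling_eq (F : FactorIndexing n P) (d : ZMod n) (m : ℤ) :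
    (F.ε * doubling n d = ((2 * m : ℤ) : ZMod (2 * n)) ∨
      F.ε * doubling n d = ((-(2 * m) : ℤ) : ZMod (2 * n))) ↔ d = m ∨ d = -m := by
  have h : ∀ m : ℤ, doubling n d = ((2 * m : ℤ) : ZMod (2 * n)) ↔ d = m := fun m => by
    rw [← doubling_intCast, doubling_injective.eq_iff]
  have h1 := h m
  have h2 := h (-m)
  rcases F.ε_eq with hε | hε <;> rw [hε] <;> push_cast at h1 h2 ⊢
  · rw [one_mul, h1, ← mul_neg, h2]
  · rw [neg_one_mul, neg_eq_iff_eq_neg, neg_inj, h1, ← mul_neg, h2, or_comm]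

lemma even_sign_mul_doubling (F : FactorIndexing n P) (d : ZMod n) :
    Even (F.ε * doubling n d : ZMod (2 * n)) :=
  ((even_iff_exists_doubling _).2 ⟨d, rfl⟩).mul_left _

lemma bracket_AA [NeZero n] (F : FactorIndexing n P) (hn : 5 ≤ n) (i j : ZMod n) :
    poissonBracket n (elemMonomial n (F.φA i)) (elemMonomial n (F.φA j)) = 0 ↔
      j - i ≠ 1 ∧ j - i ≠ -1 ∧ j - i ≠ 2 ∧ j - i ≠ -2 := by
  rw [poissonBracket_elem_elem hn _ _ (by rw [F.φA_sub]; exact F.even_sign_mul_doubling _),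
    F.φA_sub]
  generalize j - i = d
  have h1 := F.sign_mul_doubling_eq d 1
  have h2 := F.sign_mul_doubling_eq d 2
  norm_num at h1 h2
  simp only [ne_eq]
  rw [← and_assoc, ← not_or, ← not_or, h1, h2, not_or, not_or, and_assoc]

lemma bracket_BB [NeZero n] (F : FactorIndexing n P) (hn : 5 ≤ n) (i j : ZMod n) :
    poissonBracket n (X (F.φB i)) (X (F.φB j)) = 0 ↔ j - i ≠ 1 ∧ j - i ≠ -1 := by
  rw [poissonBracket_X_X hn, F.φB_sub]
  generalize j - i = d
  have h1 := F.sign_mul_doubling_eq d 1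
  norm_num at h1
  simp only [ne_eq]
  rw [← not_or, h1, not_or]

lemma bracket_AB [NeZero n] (F : FactorIndexing n P) (hn : 5 ≤ n) (i j : ZMod n) :
    poissonBracket n (elemMonomial n (F.φA i)) (X (F.φB j)) = 0 ↔
      j - i ≠ 0 ∧ j - i ≠ -1 ∧ j - i ≠ 1 ∧ j - i ≠ -2 := by
  have hodd : ¬ Even (F.φB j - F.φA i) := by
    rw [F.φB_sub_φA, not_even_iff]
    have := F.even_sign_mul_doubling (j - i)
    rcases F.ε_eq with hε | hε <;> rw [hε] at this ⊢ <;> push_cast at this ⊢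
    · rw [one_mul] at this ⊢
      rw [show doubling n (j - i) + 1 + 1 = doubling n (j - i) + (1 + 1) by ring]
      exact this.add ⟨1, rfl⟩
    · convert this using 1
      ring
  rw [poissonBracket_elem_X hn _ _ hodd, F.φB_sub_φA]
  generalize j - i = d
  have h : ∀ m : ℤ, doubling n d = ((2 * m : ℤ) : ZMod (2 * n)) ↔ d = m := fun m => by
    rw [← doubling_intCast, doubling_injective.eq_iff]
  have h0 := h 0
  have h1 := h 1
  have h2 := h (-1)
  have h3 := h (-2)
  norm_num at h0 h1 h2 h3
  rw [← doubling_injective.eq_iff, map_zero] at h0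
  rw [Ne, Ne, Ne, Ne, Ne, Ne, Ne, Ne, ← h1, ← h2, ← h3, ← doubling_injective.eq_iff (b := 0),
    map_zero]
  generalize doubling n d = z
  have k (ε r s : ZMod (2 * n)) (hε : ε * ε = 1) (hs : ε * r - 1 = s) : ε * (z + 1) = r ↔ z = s := by
    subst hs
    constructor
    · rintro rfl
      linear_combination -(z + 1) * hε
    · rintro rfl
      linear_combination r * hε
  rcases F.ε_eq with hε | hε <;> rw [hε]
  · rw [k _ 1 0 (by norm_num) (by norm_num), k _ (-1) (-2) (by norm_num) (by norm_num),
      k _ 3 2 (by norm_num) (by norm_num), k _ (-3) (-4) (by norm_num) (by norm_num)]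
  · rw [k _ 1 (-2) (by norm_num) (by norm_num), k _ (-1) 0 (by norm_num) (by norm_num),
      k _ 3 (-4) (by norm_num) (by norm_num), k _ (-3) 2 (by norm_num) (by norm_num)]
    tauto

/-- Read as shifts in ℤ/n, the vanishing brackets say that the blocks {i - 1, i} for i ∈ A and {j}
for j ∈ B are pairwise disjoint and not adjacent. -/
lemma isAdmissible_map [NeZero n] (F : FactorIndexing n P) (hn : 5 ≤ n) (A B : Finset (ZMod n)) :
    IsAdmissible n (A.map F.φA) (B.map F.φB) ↔ IsRunPair A B := by
  simp only [IsAdmissible, Finset.forall_mem_map, F.bracket_AA hn, F.bracket_AB hn,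
    F.bracket_BB hn]
  constructor
  · rintro ⟨hAA, hAB, hBB⟩
    refine ⟨fun i hi => ⟨fun h => ?_, fun h => ?_, fun h => ?_, fun h => ?_, fun h => ?_,
      fun h => ?_⟩, fun i hi h => ?_⟩
    · exact (hAA i hi _ h).1 (by ring)
    · exact (hAA i hi _ h).2.2.1 (by ring)
    · exact (hAB i hi _ h).2.2.2 (by ring)
    · exact (hAB i hi _ h).2.1 (by ring)
    · exact (hAB i hi _ h).1 (by ring)
    · exact (hAB i hi _ h).2.2.1 (by ring)
    · exact (hBB i hi _ h).1 (by ring)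
  · rintro ⟨hA, hB⟩
    refine ⟨fun i hi j hj => ⟨fun h => ?_, fun h => ?_, fun h => ?_, fun h => ?_⟩,
      fun i hi j hj => ⟨fun h => ?_, fun h => ?_, fun h => ?_, fun h => ?_⟩,
      fun i hi j hj => ⟨fun h => ?_, fun h => ?_⟩⟩
    · obtain rfl : j = i + 1 := by linear_combination h
      exact (hA i hi).1 hj
    · obtain rfl : i = j + 1 := by linear_combination -h
      exact (hA j hj).1 hi
    · obtain rfl : j = i + 2 := by linear_combination h
      exact (hA i hi).2.1 hj
    · obtain rfl : i = j + 2 := by linear_combination -h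
      exact (hA j hj).2.1 hi
    · obtain rfl : j = i := by linear_combination h
      exact (hA j hi).2.2.2.2.1 hj
    · obtain rfl : j = i - 1 := by linear_combination h
      exact (hA i hi).2.2.2.1 hj
    · obtain rfl : j = i + 1 := by linear_combination h
      exact (hA i hi).2.2.2.2.2 hj
    · obtain rfl : j = i - 2 := by linear_combination h
      exact (hA i hi).2.2.1 hj
    · obtain rfl : j = i + 1 := by linear_combination h
      exact hB i hi hj
    · obtain rfl : i = j + 1 := by linear_combination -h
      exact hB j hj hi

lemma elemMonomial_φA (F : FactorIndexing n P) (i : ZMod n) :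
    elemMonomial n (F.φA i) = X (F.φB (i - 1)) * X (F.φA i) * X (F.φB i) := by
  have h : F.φB (i - 1) = F.φA i - F.ε := by
    have := F.φB_sub_φA i (i - 1)
    rw [show i - 1 - i = -1 by ring, map_neg, doubling_one] at this
    linear_combination this
  rw [elemMonomial, h, F.φB_eq]
  rcases F.ε_eq with hε | hε <;> rw [hε] <;> push_cast
  · rfl
  · rw [sub_neg_eq_add, ← sub_eq_add_neg]
    ring

lemma exists_map_eq (φ : ZMod n ↪ ZMod (2 * n)) (S : Finset (ZMod (2 * n)))
    (h : ∀ j ∈ S, ∃ i, φ i = j) : ∃ T : Finset (ZMod n), T.map φ = S :=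
  ⟨S.preimage φ φ.injective.injOn, by
    classical
    rw [Finset.map_eq_image, Finset.image_preimage, Finset.filter_true_of_mem]
    exact h⟩

lemma exists_isRunPair [NeZero n] (F : FactorIndexing n P) (hn : 5 ≤ n)
    {S : Finset (ZMod (2 * n)) × Finset (ZMod (2 * n))} (h1 : ∀ i ∈ S.1, P i)
    (h2 : ∀ j ∈ S.2, ¬ P j) (h3 : IsAdmissible n S.1 S.2) :
    ∃ T : Finset (ZMod n) × Finset (ZMod n),
      (T.1.map F.φA, T.2.map F.φB) = S ∧ IsRunPair T.1 T.2 := by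
  obtain ⟨A, hA⟩ := exists_map_eq F.φA S.1 fun j hj => (F.prop_iff j).1 (h1 j hj)
  obtain ⟨B, hB⟩ := exists_map_eq F.φB S.2 fun j hj => (F.not_prop_iff j).1 (h2 j hj)
  refine ⟨(A, B), Prod.ext hA hB, ?_⟩
  rwa [← hA, ← hB, F.isAdmissible_map hn] at h3

open Classical in
/-- The sum of all `admissibleSum`s is the partition function of the run model. -/
lemma sum_admissibleSum [NeZero n] (F : FactorIndexing n P) (hn : 5 ≤ n) :
    ∑ k ∈ Finset.range (n / 2 + 1), admissibleSum n P k =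
      ∑ S : Finset (ZMod n) × Finset (ZMod n) with IsRunPair S.1 S.2,
        (∏ i ∈ S.1, X (F.φB (i - 1)) * X (F.φA i) * X (F.φB i)) * ∏ i ∈ S.2, -X (F.φB i) := by
  simp only [admissibleSum, Finset.sum_filter]
  rw [Finset.sum_comm]
  have key : ∀ (S : Finset (ZMod (2 * n)) × Finset (ZMod (2 * n)))
      (f : MvPolynomial (ZMod (2 * n)) ℤ),
      (∑ k ∈ Finset.range (n / 2 + 1), if (∀ i ∈ S.1, P i) ∧ (∀ j ∈ S.2, ¬ P j) ∧
        S.1.card + S.2.card = k ∧ IsAdmissible n S.1 S.2 then f else 0) =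
      if (∀ i ∈ S.1, P i) ∧ (∀ j ∈ S.2, ¬ P j) ∧ IsAdmissible n S.1 S.2 then f else 0 := by
    intro S f
    by_cases h : (∀ i ∈ S.1, P i) ∧ (∀ j ∈ S.2, ¬ P j) ∧ IsAdmissible n S.1 S.2
    · obtain ⟨T, rfl, hT⟩ := F.exists_isRunPair hn h.1 h.2.1 h.2.2
      -- The cut-off k ≤ n/2 discards no admissible pair, and each pair is counted for exactly one
      -- k.
      have := hT.two_mul_card_le
      rw [if_pos h, Finset.sum_eq_single (T.1.card + T.2.card)]
      · rw [if_pos ⟨h.1, h.2.1, by simp, h.2.2⟩]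
      · intro k _ hk
        rw [if_neg]
        rintro ⟨-, -, h', -⟩
        exact hk (by simpa using h'.symm)
      · intro h'
        rw [Finset.mem_range] at h'
        omega
    · rw [if_neg h]
      refine Finset.sum_eq_zero fun k _ => if_neg ?_
      tauto
  simp only [key]
  simp only [← Finset.sum_filter]
  symm
  refine Finset.sum_bij (fun S _ => (S.1.map F.φA, S.2.map F.φB)) ?_ ?_ ?_ ?_
  · intro S hS
    simp only [Finset.mem_filter, Finset.mem_univ, true_and, Finset.forall_mem_map] at hS ⊢
    exact ⟨fun i _ => (F.prop_iff _).2 ⟨i, rfl⟩, fun i _ => (F.not_prop_iff _).2 ⟨i, rfl⟩,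
      (F.isAdmissible_map hn _ _).2 hS⟩
  · intro S _ T _ h
    rw [Prod.mk.injEq] at h
    exact Prod.ext (Finset.map_injective _ h.1) (Finset.map_injective _ h.2)
  · intro S hS
    simp only [Finset.mem_filter, Finset.mem_univ, true_and] at hS
    obtain ⟨T, hT, hT'⟩ := F.exists_isRunPair hn hS.1 hS.2.1 hS.2.2
    exact ⟨T, by simpa using hT', hT⟩
  · intro S _
    simp only [Finset.prod_map, Finset.card_map, F.elemMonomial_φA, Finset.prod_neg]
    ring

lemma sum_admissibleSum_eq_trace [NeZero n] (F : FactorIndexing n P) (hn : 5 ≤ n) :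
    ∑ k ∈ Finset.range (n / 2 + 1), admissibleSum n P k =
      (orderedProd (fun i : ℕ => transferMatrix (X (F.φB i)) (X (F.φA i))) n).trace := by
  classical
  rw [F.sum_admissibleSum hn,
    trace_orderedProd_transferMatrix (fun i => X (F.φB i)) (fun i => X (F.φA i))]

end FactorIndexing

lemma even_or_even_sub_one (j : ZMod (2 * n)) : ¬ Even j ↔ ∃ i, doubling n i - 1 = j := by
  rw [not_even_iff, even_iff_exists_doubling]
  simp only [sub_eq_iff_eq_add]

/-- The factors of the monomials of `E_k`. -/
def factorIndexingE (n : ℕ) : FactorIndexing n (fun i => ¬ Even i) where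
  φA := ⟨fun i => doubling n i - 1, fun i j h => doubling_injective (by simpa using h)⟩
  φB := ⟨fun i => doubling n i, doubling_injective⟩
  ε := 1
  ε_eq := Or.inl rfl
  prop_iff := even_or_even_sub_one
  not_prop_iff j := by
    rw [not_not]
    exact even_iff_exists_doubling j
  φA_sub i j := by
    change doubling n i - 1 - (doubling n j - 1) = _
    simp
  φB_eq i := by
    change doubling n i = doubling n i - 1 + _
    simp

/-- The factors of the monomials of `O_k`. -/
def factorIndexingO (n : ℕ) : FactorIndexing n (fun i => Even i) where
  -- The reflection -1 - i is the reversed order of factors produced by the adjugate, so the trace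
  -- formula applies to it literally.
  φA := ⟨fun i => doubling n (-1 - i), fun i j h => by simpa using doubling_injective h⟩
  φB := ⟨fun i => doubling n (-1 - i) - 1, fun i j h => by
    simpa using doubling_injective (sub_left_injective h)⟩
  ε := -1
  ε_eq := Or.inr rfl
  prop_iff j := by
    rw [even_iff_exists_doubling]
    exact ((Equiv.subLeft (-1 : ZMod n)).exists_congr_left.trans (by simp [Equiv.subLeft])).symm
  not_prop_iff j := by
    rw [even_or_even_sub_one]
    exact ((Equiv.subLeft (-1 : ZMod n)).exists_congr_left.trans (by simp [Equiv.subLeft])).symm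
  φA_sub i j := by
    change doubling n (-1 - i) - doubling n (-1 - j) = _
    rw [← map_sub]
    push_cast
    rw [neg_one_mul, ← map_neg]
    congr 1
    ring
  φB_eq i := by
    change doubling n (-1 - i) - 1 = doubling n (-1 - i) + _
    simp [sub_eq_add_neg]

/-- The monodromy matrix over the polynomial ring. -/
noncomputable def monodromy (n : ℕ) : Matrix (Fin 3) (Fin 3) (MvPolynomial (ZMod (2 * n)) ℤ) :=
  orderedProd (fun i : ℕ => transferMatrix (X (doubling n i)) (X (doubling n i - 1))) n

theorem trace_monodromy [NeZero n] (hn : 5 ≤ n) :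
    (monodromy n).trace = ∑ k ∈ Finset.range (n / 2 + 1), polyE n k :=
  ((factorIndexingE n).sum_admissibleSum_eq_trace hn).symm

lemma polyETop_eq [NeZero n] : polyETop n = ∏ i : ZMod n, X (doubling n i) := by
  classical
  rw [polyETop]
  have : ({i | Even i} : Finset (ZMod (2 * n))) =
      Finset.univ.map ⟨doubling n, doubling_injective⟩ := by
    ext j
    simp [even_iff_exists_doubling]
  rw [this, Finset.prod_map]
  rfl

lemma polyOTop_eq [NeZero n] : polyOTop n = ∏ i : ZMod n, X (doubling n i - 1) := by
  classical
  rw [polyOTop]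
  have : ({i | ¬ Even i} : Finset (ZMod (2 * n))) =
      Finset.univ.map (factorIndexingE n).φA := by
    ext j
    simp only [even_or_even_sub_one, Finset.mem_filter, Finset.mem_univ, true_and,
      Finset.mem_map]
    rfl
  rw [this, Finset.prod_map]
  rfl

theorem det_monodromy [NeZero n] : (monodromy n).det = polyETop n ^ 2 * polyOTop n := by
  rw [polyETop_eq, polyOTop_eq]
  exact det_orderedProd_transferMatrix (fun i => X (doubling n i)) fun i => X (doubling n i - 1)

theorem trace_adjugate_monodromy [NeZero n] (hn : 5 ≤ n) :
    (monodromy n).adjugate.trace =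
      polyETop n * ∑ k ∈ Finset.range (n / 2 + 1), polyO n k := by
  rw [polyETop_eq]
  refine (trace_adjugate_orderedProd_transferMatrix (fun i => X (doubling n i))
    fun i => X (doubling n i - 1)).trans ?_
  congr 1
  exact ((factorIndexingO n).sum_admissibleSum_eq_trace hn).symm

end Monodromy

/-! ### The monodromy of a closed polygon is scalar -/

section Geometry

variable {𝕜 : Type*} [RCLike 𝕜]

/-- A cross ratio is a quotient of products of 2 × 2 determinants, each of which can be computed
from the coordinates in u, w. The form without division avoids assuming d and e nonzero. -/
lemma IsCrossRatio.mul_eq {p₁ p₂ p₃ p₄ : ProjPlane 𝕜} {r : 𝕜} (h : IsCrossRatio p₁ p₂ p₃ p₄ r)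
    {u w : Fin 3 → 𝕜} (huw : LinearIndependent 𝕜 ![u, w]) {c d e f : 𝕜}
    (h₁ : u ∈ p₁.submodule) (h₂ : w ∈ p₂.submodule) (h₃ : c • u + d • w ∈ p₃.submodule)
    (h₄ : e • u + f • w ∈ p₄.submodule) : r * (d * e) = d * e - c * f := by
  obtain ⟨a, b, t₁, t₂, t₃, t₄, hab, e₁, e₂, e₃, e₄, h13, h24, rfl⟩ := h
  rw [e₁, Submodule.mem_span_singleton] at h₁
  rw [e₂, Submodule.mem_span_singleton] at h₂
  rw [e₃, Submodule.mem_span_singleton] at h₃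
  rw [e₄, Submodule.mem_span_singleton] at h₄
  obtain ⟨k₁, rfl⟩ := h₁
  obtain ⟨k₂, rfl⟩ := h₂
  obtain ⟨k₃, h₃⟩ := h₃
  obtain ⟨k₄, h₄⟩ := h₄
  rw [LinearIndependent.pair_iff] at hab huw
  obtain ⟨c1, c2⟩ := hab (c * k₁ + d * k₂ - k₃) (c * k₁ * t₁ + d * k₂ * t₂ - k₃ * t₃) (by
    have := sub_eq_zero.2 h₃.symm
    rw [← this]
    module)
  obtain ⟨c3, c4⟩ := hab (e * k₁ + f * k₂ - k₄) (e * k₁ * t₁ + f * k₂ * t₂ - k₄ * t₄) (by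
    have := sub_eq_zero.2 h₄.symm
    rw [← this]
    module)
  have hD : k₁ * k₂ * (t₂ - t₁) ≠ 0 := by
    intro h0
    have h5 := huw k₂ (-k₁) (by
      have : k₂ • k₁ • (a + t₁ • b) + -k₁ • k₂ • (a + t₂ • b) = (-(k₁ * k₂ * (t₂ - t₁))) • b := by
        module
      rw [this, h0, neg_zero, zero_smul])
    have h6 := huw 1 0 (by simp [neg_eq_zero.1 h5.2])
    exact one_ne_zero h6.1
  have h13' := sub_ne_zero.2 h13
  have h24' := sub_ne_zero.2 h24
  -- Determinants of pairs of representatives, computed in the basis a, b and compared with det(u,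
  -- w) = k₁k₂(t₂ - t₁).
  have i13 : k₁ * k₃ * (t₃ - t₁) = d * (k₁ * k₂ * (t₂ - t₁)) := by
    linear_combination k₁ * t₁ * c1 - k₁ * c2
  have i24 : k₂ * k₄ * (t₂ - t₄) = e * (k₁ * k₂ * (t₂ - t₁)) := by
    linear_combination k₂ * c4 - k₂ * t₂ * c3
  have i34 : k₃ * k₄ * (t₄ - t₃) = (c * f - d * e) * (k₁ * k₂ * (t₂ - t₁)) := by
    linear_combination k₃ * t₃ * c3 - k₃ * c4 - (e * k₁ * t₁ + f * k₂ * t₂) * c1 +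
      (e * k₁ + f * k₂) * c2
  refine mul_right_cancel₀ (mul_ne_zero hD hD) ?_
  have : ((t₁ - t₂) * (t₃ - t₄)) / ((t₁ - t₃) * (t₂ - t₄)) * (d * e) *
      (k₁ * k₂ * (t₂ - t₁) * (k₁ * k₂ * (t₂ - t₁))) =
      ((t₁ - t₂) * (t₃ - t₄)) / ((t₁ - t₃) * (t₂ - t₄)) *
        ((k₁ * k₃ * (t₃ - t₁)) * (k₂ * k₄ * (t₂ - t₄))) := by
    rw [i13, i24]
    ring
  rw [this]
  have : ((t₁ - t₂) * (t₃ - t₄)) / ((t₁ - t₃) * (t₂ - t₄)) *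
        ((k₁ * k₃ * (t₃ - t₁)) * (k₂ * k₄ * (t₂ - t₄))) =
      -(k₁ * k₂ * (t₂ - t₁)) * (k₃ * k₄ * (t₄ - t₃)) := by
    field_simp
    ring
  rw [this, i34]
  ring

lemma IsMeet.mem {p a b c d : ProjPlane 𝕜} (h : IsMeet p a b c d) {w : Fin 3 → 𝕜}
    (h₁ : w ∈ a.submodule ⊔ b.submodule) (h₂ : w ∈ c.submodule ⊔ d.submodule) :
    w ∈ p.submodule := by
  rw [h]
  exact ⟨h₁, h₂⟩

lemma rep_mem_submodule (p : ProjPlane 𝕜) : p.rep ∈ p.submodule := by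
  rw [Projectivization.submodule_eq]
  exact Submodule.mem_span_singleton_self _

lemma smul_add_smul_rep_mem (p q : ProjPlane 𝕜) (c d : 𝕜) :
    c • p.rep + d • q.rep ∈ p.submodule ⊔ q.submodule :=
  Submodule.add_mem_sup (Submodule.smul_mem _ _ (rep_mem_submodule p))
    (Submodule.smul_mem _ _ (rep_mem_submodule q))

/-- The coefficients are quantified before the hypotheses so that they can be chosen as functions of
the four vectors alone. Each is nonzero because otherwise u₃ would be dependent on two of the
others. -/
lemma exists_recurrence (u₀ u₁ u₂ u₃ : Fin 3 → 𝕜) : ∃ A B C : 𝕜,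
    LinearIndependent 𝕜 ![u₀, u₁, u₂] → LinearIndependent 𝕜 ![u₀, u₁, u₃] →
    LinearIndependent 𝕜 ![u₀, u₂, u₃] → LinearIndependent 𝕜 ![u₁, u₂, u₃] →
    A ≠ 0 ∧ B ≠ 0 ∧ C ≠ 0 ∧ u₃ = A • u₂ + B • u₁ + C • u₀ := by
  by_cases h : LinearIndependent 𝕜 ![u₀, u₁, u₂]
  swap
  · exact ⟨0, 0, 0, fun h' => absurd h' h⟩
  have hspan := h.span_eq_top_of_card_eq_finrank (by simp)
  have : u₃ ∈ Submodule.span 𝕜 (Set.range ![u₀, u₁, u₂]) := by rw [hspan]; trivial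
  obtain ⟨g, hg⟩ := (Submodule.mem_span_range_iff_exists_fun 𝕜).1 this
  simp only [Fin.sum_univ_three, Matrix.cons_val_zero, Matrix.cons_val_one, Matrix.cons_val] at hg
  refine ⟨g 2, g 1, g 0, fun _ h₁ h₂ h₃ => ⟨fun h0 => ?_, fun h0 => ?_, fun h0 => ?_, ?_⟩⟩
  · have := Fintype.linearIndependent_iff.1 h₁ ![g 0, g 1, -1] (by
      simp [Fin.sum_univ_three, ← hg, h0]
      abel) 2
    simp at this
  · have := Fintype.linearIndependent_iff.1 h₂ ![g 0, g 2, -1] (by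
      simp [Fin.sum_univ_three, ← hg, h0]
      abel) 2
    simp at this
  · have := Fintype.linearIndependent_iff.1 h₃ ![g 1, g 2, -1] (by
      simp [Fin.sum_univ_three, ← hg, h0]
      abel) 2
    simp at this
  · rw [← hg]
    module

lemma IsGeneric.linearIndependent {v : ℤ → ProjPlane 𝕜} (hv : IsGeneric v) (i : ℤ) :
    LinearIndependent 𝕜 ![(v (i - 1)).rep, (v i).rep, (v (i + 1)).rep] ∧
    LinearIndependent 𝕜 ![(v (i - 1)).rep, (v i).rep, (v (i + 2)).rep] ∧
    LinearIndependent 𝕜 ![(v (i - 1)).rep, (v (i + 1)).rep, (v (i + 2)).rep] ∧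
    LinearIndependent 𝕜 ![(v i).rep, (v (i + 1)).rep, (v (i + 2)).rep] := by
  have h := hv (i - 1)
  simp only [Projectivization.independent_iff] at h
  rw [show i - 1 + 1 = i by ring, show i - 1 + 2 = i + 1 by ring,
    show i - 1 + 3 = i + 2 by ring] at h
  have e (a b c : ProjPlane 𝕜) : Projectivization.rep ∘ ![a, b, c] = ![a.rep, b.rep, c.rep] := by
    ext j
    fin_cases j <;> rfl
  simpa only [e] using h

lemma linearIndependent_pair_of_triple {u₀ u₁ u₂ : Fin 3 → 𝕜}
    (h : LinearIndependent 𝕜 ![u₀, u₁, u₂]) : LinearIndependent 𝕜 ![u₀, u₁] := by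
  have := h.comp ![0, 1] (by decide)
  convert this using 1
  ext j
  fin_cases j <;> rfl

/-- The lifts of a closed polygon satisfy a periodic recurrence, whose coefficients determine the
corner invariants. -/
lemma exists_periodic_recurrence {n : ℕ} {v : ℤ → ProjPlane 𝕜} {x : ZMod (2 * n) → 𝕜}
    (hc : IsClosedPolygon n v) (hg : IsGeneric v) (hx : HasCornerInvariants n v x) :
    ∃ A B C : ℤ → 𝕜, (∀ i, A i ≠ 0 ∧ B i ≠ 0 ∧ C i ≠ 0) ∧ (∀ i, A (i + n) = A i) ∧
      (∀ i, (v (i + 2)).rep = A i • (v (i + 1)).rep + B i • (v i).rep + C i • (v (i - 1)).rep) ∧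
      (∀ i : ℤ, x ((2 * i : ℤ) : ZMod (2 * n)) = - B i / (A i * A (i - 1))) ∧
      ∀ i : ℤ, x ((2 * i - 1 : ℤ) : ZMod (2 * n)) = A (i - 1) * C i / (B i * B (i - 1)) := by
  -- As `rep` depends only on the point, the lifts are periodic, and so is any coefficient chosen as
  -- a function of them.
  choose A' B' C' h' using exists_recurrence (𝕜 := 𝕜)
  set q : ℤ → 𝕜 := fun i =>
    A' (v (i - 1)).rep (v i).rep (v (i + 1)).rep (v (i + 2)).rep with hq
  set b : ℤ → 𝕜 := fun i =>
    B' (v (i - 1)).rep (v i).rep (v (i + 1)).rep (v (i + 2)).rep with hb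
  set c : ℤ → 𝕜 := fun i =>
    C' (v (i - 1)).rep (v i).rep (v (i + 1)).rep (v (i + 2)).rep with hc'
  have hrec (i : ℤ) := h' _ _ _ _ (hg.linearIndependent i).1 (hg.linearIndependent i).2.1
    (hg.linearIndependent i).2.2.1 (hg.linearIndependent i).2.2.2
  change ∀ i, q i ≠ 0 ∧ b i ≠ 0 ∧ c i ≠ 0 ∧
    _ = q i • (v (i + 1)).rep + b i • (v i).rep + c i • (v (i - 1)).rep at hrec
  clear_value b c
  refine ⟨q, b, c, fun i => ⟨(hrec i).1, (hrec i).2.1, (hrec i).2.2.1⟩, fun i => ?_,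
    fun i => (hrec i).2.2.2, fun i => ?_, fun i => ?_⟩
  · have e1 := hc (i - 1)
    have e2 := hc (i + 1)
    have e3 := hc (i + 2)
    rw [show i - 1 + (n : ℤ) = i + n - 1 by ring] at e1
    rw [show i + 1 + (n : ℤ) = i + n + 1 by ring] at e2
    rw [show i + 2 + (n : ℤ) = i + n + 2 by ring] at e3
    simp only [hq, e1, e2, e3, hc i]
  · obtain ⟨hA, hB, hC, r⟩ := hrec i
    obtain ⟨hA', hB', hC', r'⟩ := hrec (i - 1)
    rw [show i - 1 + 2 = i + 1 by ring, show i - 1 + 1 = i by ring,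
      show i - 1 - 1 = i - 2 by ring] at r'
    obtain ⟨P, Q, hP, hQ, hcr⟩ := (hx i).2
    have hind : LinearIndependent 𝕜 ![(v (i + 2)).rep, (v (i + 1)).rep] :=
      (linearIndependent_pair_of_triple (u₂ := (v i).rep)
        (by
          have := (hg.linearIndependent i).2.2.2.comp ![2, 1, 0] (by decide)
          convert this using 1
          ext j
          fin_cases j <;> rfl))
    -- Write u for the lifts. The first meet is u_{i+2} - A_i u_{i+1}. The second is A_{i-1} times
    -- this minus B_i u_{i+1}: the term in u_i then cancels against the previous recurrence.
    have := hcr.mul_eq hind (c := 1) (d := - q i) (e := q (i - 1)) (f := - q i * q (i - 1) - b i)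
      (rep_mem_submodule _) (rep_mem_submodule _)
      (hP.mem (smul_add_smul_rep_mem _ _ _ _) (by
        convert smul_add_smul_rep_mem (v i) (v (i - 1)) (b i) (c i) using 1
        rw [r]; module))
      (hQ.mem (smul_add_smul_rep_mem _ _ _ _) (by
        convert smul_add_smul_rep_mem (v (i - 1)) (v (i - 2)) (q (i - 1) * c i - b i * b (i - 1))
          (- b i * c (i - 1)) using 1
        rw [r, r']; module))
    rw [eq_div_iff (mul_ne_zero hA hA')]
    linear_combination -this
  · obtain ⟨hA, hB, hC, r⟩ := hrec i
    obtain ⟨hA', hB', hC', r'⟩ := hrec (i - 1)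
    have hind := (hg.linearIndependent (i - 1)).1
    rw [show i - 1 + 2 = i + 1 by ring, show i - 1 + 1 = i by ring,
      show i - 1 - 1 = i - 2 by ring] at r'
    rw [show i - 1 - 1 = i - 2 by ring] at hind
    obtain ⟨P, Q, hP, hQ, hcr⟩ := (hx i).1
    -- The second meet is the same point as for the even invariant, with the same representative,
    -- now expanded in u_{i-2} and u_{i-1}.
    have := hcr.mul_eq (linearIndependent_pair_of_triple hind) (c := c (i - 1)) (d := b (i - 1))
      (e := - b i * c (i - 1)) (f := q (i - 1) * c i - b i * b (i - 1))
      (rep_mem_submodule _) (rep_mem_submodule _)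
      (hP.mem (smul_add_smul_rep_mem _ _ _ _) (by
        convert smul_add_smul_rep_mem (v i) (v (i + 1)) (- q (i - 1)) 1 using 1
        rw [r']; module))
      (hQ.mem (smul_add_smul_rep_mem _ _ _ _) (by
        convert smul_add_smul_rep_mem (v (i + 1)) (v (i + 2)) (- q i * q (i - 1) - b i)
          (q (i - 1)) using 1
        rw [r, r']; module))
    rw [eq_div_iff (mul_ne_zero hB hB')]
    refine mul_right_cancel₀ hC' ?_
    linear_combination -this

/-- A recurrence `U (m + 3) = U (m + 2) - a m • U (m + 1) + (a m * b m * a (m - 1)) • U m` is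
propagated by the transfer matrices. -/
lemma frame_mul_orderedProd (a b : ℤ → 𝕜) (U : ℕ → Fin 3 → 𝕜)
    (hU : ∀ m : ℕ, U (m + 3) = U (m + 2) - a m • U (m + 1) + (a m * b m * a (m - 1)) • U m)
    (F : ℕ → Matrix (Fin 3) (Fin 3) 𝕜)
    (hF : ∀ m : ℕ, F m = Matrix.of fun k => ![U (m + 1) k, U (m + 2) k - U (m + 1) k,
      a (m - 1) * U m k]) (m : ℕ) :
    F 0 * orderedProd (fun i : ℕ => transferMatrix (a i) (b i)) m = F m := by
  induction m with
  | zero => simp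
  | succ m ih =>
    rw [orderedProd_succ, ← mul_assoc, ih, hF, hF]
    have := hU m
    ext k j
    rw [show m + 1 + 1 = m + 2 by rfl, show m + 1 + 2 = m + 3 by rfl, this]
    fin_cases j <;> simp [Matrix.mul_apply, Fin.sum_univ_three, transferMatrix] <;> ring

/-- The monodromy matrix of a closed polygon, at its corner invariants, is scalar; and the corner
invariants do not vanish. -/
theorem monodromy_scalar {n : ℕ} [NeZero n] {x : ZMod (2 * n) → 𝕜}
    (hx : x ∈ closedPolygonLocus 𝕜 n) :
    (∀ i, x i ≠ 0) ∧ ∃ c : 𝕜, orderedProd (fun i : ℕ =>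
      transferMatrix (x (doubling n i)) (x (doubling n i - 1))) n = c • 1 := by
  obtain ⟨v, hc, hg, hx⟩ := hx
  obtain ⟨A, B, C, h0, hA, hrec, hxe, hxo⟩ := exists_periodic_recurrence hc hg hx
  set a : ℤ → 𝕜 := fun i => x ((2 * i : ℤ) : ZMod (2 * n)) with ha
  set b : ℤ → 𝕜 := fun i => x ((2 * i - 1 : ℤ) : ZMod (2 * n)) with hb
  have ha0 (i : ℤ) : a i ≠ 0 := by
    simp only [ha, hxe]
    exact div_ne_zero (neg_ne_zero.2 (h0 i).2.1) (mul_ne_zero (h0 i).1 (h0 _).1)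
  have hb0 (i : ℤ) : b i ≠ 0 := by
    simp only [hb, hxo]
    exact div_ne_zero (mul_ne_zero (h0 _).1 (h0 i).2.2) (mul_ne_zero (h0 i).2.1 (h0 _).2.1)
  have hcoord : ∀ i, x i ≠ 0 := by
    intro i
    obtain ⟨m, rfl⟩ := ZMod.intCast_surjective i
    obtain ⟨k, rfl | rfl⟩ := Int.even_or_odd' m
    · exact ha0 k
    · have := hb0 (k + 1)
      simp only [hb] at this
      rwa [show 2 * (k + 1) - 1 = 2 * k + 1 by ring] at this
  refine ⟨hcoord, ?_⟩
  -- Rescaling that turns the leading coefficient of the recurrence into 1; the other two then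
  -- depend on the corner invariants only.
  let l : ℕ → 𝕜 := fun m => ∏ j ∈ Finset.range m, (A ((j : ℤ) - 2))⁻¹
  have hl (m : ℕ) : l m = l (m + 1) * A (m - 2) := by
    simp only [l, Finset.prod_range_succ]
    rw [mul_assoc, inv_mul_cancel₀ (h0 _).1, mul_one]
  have hl0 (m : ℕ) : l m ≠ 0 := Finset.prod_ne_zero_iff.2 fun j _ => inv_ne_zero (h0 _).1
  -- Periodicity of A makes the scaling factors multiplicative over a period, so the rescaled lifts
  -- are periodic up to the single constant `l n`.
  have hln (m : ℕ) : l (m + n) = l n * l m := by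
    simp only [l]
    rw [add_comm, Finset.prod_range_add]
    congr 1
    refine Finset.prod_congr rfl fun j _ => ?_
    rw [← hA ((j : ℤ) - 2)]
    congr 2
    push_cast
    ring
  let U : ℕ → Fin 3 → 𝕜 := fun m => l m • (v ((m : ℤ) - 1)).rep
  have hUn (m : ℕ) : U (m + n) = l n • U m := by
    simp only [U]
    rw [hln, mul_smul]
    congr 3
    rw [← hc ((m : ℤ) - 1)]
    congr 1
    push_cast
    ring
  have hU (m : ℕ) : U (m + 3) = U (m + 2) - a m • U (m + 1) + (a m * b m * a (m - 1)) • U m := by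
    have r := hrec m
    have l0 := hl m
    have l1 := hl (m + 1)
    have l2 := hl (m + 2)
    have e0 := (h0 m)
    have e1 := (h0 ((m : ℤ) - 1))
    have e2 := (h0 ((m : ℤ) - 2))
    have ea : a m = - B m / (A m * A ((m : ℤ) - 1)) := hxe m
    have ea' : a ((m : ℤ) - 1) = - B ((m : ℤ) - 1) / (A ((m : ℤ) - 1) * A ((m : ℤ) - 2)) := by
      have := hxe ((m : ℤ) - 1)
      rwa [show (m : ℤ) - 1 - 1 = m - 2 by ring] at this
    have eb : b m = A ((m : ℤ) - 1) * C m / (B m * B ((m : ℤ) - 1)) := hxo m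
    push_cast at l1 l2
    rw [show (m : ℤ) + 1 - 2 = m - 1 by ring] at l1
    rw [show (m : ℤ) + 2 - 2 = m by ring] at l2
    rw [show m + 1 + 1 = m + 2 by rfl] at l1
    rw [show m + 2 + 1 = m + 3 by rfl] at l2
    simp only [U]
    push_cast
    rw [show (m : ℤ) + 3 - 1 = m + 2 by ring, show (m : ℤ) + 2 - 1 = m + 1 by ring,
      show (m : ℤ) + 1 - 1 = m by ring, r, ea, ea', eb, l0, l1, l2]
    obtain ⟨e01, e02, e03⟩ := e0
    obtain ⟨e11, e12, e13⟩ := e1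
    obtain ⟨e21, e22, e23⟩ := e2
    ext k
    simp only [Pi.smul_apply, Pi.add_apply, Pi.sub_apply, smul_eq_mul]
    field_simp
    ring
  let F : ℕ → Matrix (Fin 3) (Fin 3) 𝕜 := fun m => Matrix.of fun k =>
    ![U (m + 1) k, U (m + 2) k - U (m + 1) k, a (m - 1) * U m k]
  have hF := frame_mul_orderedProd a b U hU F (fun m => rfl) n
  have hFn : F n = l n • F 0 := by
    have ea : a (n - 1) = a (0 - 1) := by
      simp only [ha]
      congr 1
      have := ZMod.natCast_self (2 * n)
      push_cast at this ⊢
      linear_combination this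
    have u0 := hUn 0
    have u1 := hUn 1
    have u2 := hUn 2
    rw [zero_add] at u0
    rw [add_comm] at u1 u2
    ext k j
    simp only [F, u1, u2, u0, ea]
    fin_cases j <;> simp <;> ring
  -- The initial frame is invertible by general position, so F₀ P = l_n F₀ forces P = l_n.
  have hdet : (F 0).det ≠ 0 := by
    have hi := (hg.linearIndependent 0).1
    have hM : (Matrix.of ![(v (0 - 1)).rep, (v 0).rep, (v (0 + 1)).rep]).det ≠ 0 := by
      have := (Matrix.linearIndependent_rows_iff_isUnit
        (A := Matrix.of ![(v (0 - 1)).rep, (v 0).rep, (v (0 + 1)).rep])).1 hi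
      exact ((Matrix.isUnit_iff_isUnit_det _).1 this).ne_zero
    have : (F 0).det = a (-1) * l 0 * l 1 * l 2 *
        (Matrix.of ![(v (0 - 1)).rep, (v 0).rep, (v (0 + 1)).rep]).det := by
      simp [F, U, Matrix.det_fin_three]
      ring
    rw [this]
    exact mul_ne_zero (mul_ne_zero (mul_ne_zero (mul_ne_zero (ha0 _) (hl0 _)) (hl0 _)) (hl0 _)) hM
  refine ⟨l n, ?_⟩
  have hP : orderedProd (fun i : ℕ => transferMatrix (x (doubling n i)) (x (doubling n i - 1))) n =
      orderedProd (fun i : ℕ => transferMatrix (a i) (b i)) n := by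
    refine orderedProd_congr fun i _ => ?_
    have := doubling_intCast (n := n) i
    rw [Int.cast_natCast] at this
    simp only [ha, hb, this]
    push_cast
    rfl
  rw [hP]
  have hunit : IsUnit (F 0) := (Matrix.isUnit_iff_isUnit_det _).2 (isUnit_iff_ne_zero.2 hdet)
  refine hunit.mul_left_cancel ?_
  rw [hF, hFn, Matrix.mul_smul, mul_one]

end Geometry

/-! ### Derivations and powers of an ideal -/

section Derivations

/-- By the Leibniz rule a derivation removes at most one factor from a product of elements of I. -/
lemma Derivation.apply_mem_pow {k S : Type*} [CommRing k] [CommRing S] [Algebra k S]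
    (D : Derivation k S S) (I : Ideal S) (m : ℕ) {p : S} (hp : p ∈ I ^ (m + 1)) : D p ∈ I ^ m := by
  induction m generalizing p with
  | zero => simp
  | succ m ih =>
    rw [pow_succ] at hp
    refine Submodule.mul_induction_on hp (fun a ha b hb => ?_) fun a b ha hb => ?_
    · rw [Derivation.leibniz, smul_eq_mul, smul_eq_mul]
      refine add_mem (Ideal.mul_mem_right _ _ ha) ?_
      rw [pow_succ, mul_comm b]
      exact Ideal.mul_mem_mul (ih ha) hb
    · rw [map_add]
      exact add_mem ha hb

lemma Matrix.trace_adjugate_mem_sq {S : Type*} [CommRing S] (I : Ideal S)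
    (N : Matrix (Fin 3) (Fin 3) S) (hN : ∀ i j, N i j ∈ I) : N.adjugate.trace ∈ I ^ 2 := by
  have h (i j k l : Fin 3) : N i j * N k l ∈ I ^ 2 := by
    rw [pow_two]
    exact Ideal.mul_mem_mul (hN i j) (hN k l)
  have : N.adjugate.trace = (N 1 1 * N 2 2 - N 1 2 * N 2 1) + (N 0 0 * N 2 2 - N 0 2 * N 2 0) +
      (N 0 0 * N 1 1 - N 0 1 * N 1 0) := by
    rw [Matrix.adjugate_fin_three, Matrix.trace_fin_three]
    simp
  rw [this]
  exact add_mem (add_mem (sub_mem (h _ _ _ _) (h _ _ _ _)) (sub_mem (h _ _ _ _) (h _ _ _ _)))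
    (sub_mem (h _ _ _ _) (h _ _ _ _))

lemma Matrix.det_mem_cube {S : Type*} [CommRing S] (I : Ideal S)
    (N : Matrix (Fin 3) (Fin 3) S) (hN : ∀ i j, N i j ∈ I) : N.det ∈ I ^ 3 := by
  have h (i j k l p q : Fin 3) : N i j * N k l * N p q ∈ I ^ 3 := by
    rw [pow_succ, pow_two]
    exact Ideal.mul_mem_mul (Ideal.mul_mem_mul (hN i j) (hN k l)) (hN p q)
  rw [Matrix.det_fin_three]
  exact sub_mem (add_mem (add_mem (sub_mem (sub_mem (h _ _ _ _ _ _) (h _ _ _ _ _ _))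
    (h _ _ _ _ _ _)) (h _ _ _ _ _ _)) (h _ _ _ _ _ _)) (h _ _ _ _ _ _)

/-- The invariants of a `3 × 3` matrix all of whose entries agree modulo `I` with those of a scalar
matrix. -/
lemma Matrix.invariants_of_congr_scalar {S : Type*} [CommRing S] (I : Ideal S)
    (M : Matrix (Fin 3) (Fin 3) S) (c : S) (hM : ∀ i j, (M - c • 1) i j ∈ I) :
    M.det - c ^ 2 * M.trace + 2 * c ^ 3 ∈ I ^ 2 ∧
      M.adjugate.trace - 2 * c * M.trace + 3 * c ^ 2 ∈ I ^ 2 ∧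
      c ^ 3 - c ^ 2 * M.trace + c * M.adjugate.trace - M.det ∈ I ^ 3 := by
  -- In terms of N = M - c the combinations are det N + c tr adj N, tr adj N and -det N: the parts
  -- linear in N cancel.
  obtain ⟨N, rfl⟩ : ∃ N, M = N + c • 1 := ⟨M - c • 1, by simp⟩
  rw [add_sub_cancel_right] at hM
  have h2 := Matrix.trace_adjugate_mem_sq I N hM
  have h3 := Matrix.det_mem_cube I N hM
  have e1 : (N + c • 1).det = N.det + c * N.adjugate.trace + c ^ 2 * N.trace + c ^ 3 := by
    rw [Matrix.adjugate_fin_three, Matrix.trace_fin_three, Matrix.trace_fin_three,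
      Matrix.det_fin_three, Matrix.det_fin_three]
    simp
    ring
  have e2 : (N + c • 1).adjugate.trace = N.adjugate.trace + 2 * c * N.trace + 3 * c ^ 2 := by
    rw [Matrix.adjugate_fin_three, Matrix.adjugate_fin_three, Matrix.trace_fin_three,
      Matrix.trace_fin_three, Matrix.trace_fin_three]
    simp
    ring
  have e3 : (N + c • (1 : Matrix (Fin 3) (Fin 3) S)).trace = N.trace + 3 * c := by
    rw [Matrix.trace_add, Matrix.trace_smul, Matrix.trace_one]
    simp [mul_comm]
  rw [e1, e2, e3]
  refine ⟨?_, ?_, ?_⟩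
  · convert add_mem (Ideal.pow_le_pow_right (by norm_num : 2 ≤ 3) h3) (Ideal.mul_mem_left _ c h2)
      using 1
    ring
  · convert h2 using 1
    ring
  · convert neg_mem h3 using 1
    ring

end Derivations

/-! ### Differentials of polynomial functions -/

section Differentials

variable {𝕜 σ : Type*} [RCLike 𝕜] [Fintype σ]

lemma MvPolynomial.differentiableAt_eval (p : MvPolynomial σ 𝕜) (x : σ → 𝕜) :
    DifferentiableAt 𝕜 (fun y => eval y p) x :=
  (AnalyticOnNhd.eval_mvPolynomial p x (Set.mem_univ x)).differentiableAt

/-- The differential at `x` of a polynomial function. -/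
noncomputable def polyDifferential (x : σ → 𝕜) : MvPolynomial σ 𝕜 →ₗ[𝕜] ((σ → 𝕜) →L[𝕜] 𝕜) where
  toFun p := fderiv 𝕜 (fun y => eval y p) x
  map_add' p q := by
    simp only [map_add]
    exact fderiv_fun_add (p.differentiableAt_eval x) (q.differentiableAt_eval x)
  map_smul' c p := by
    simp only [smul_eval, RingHom.id_apply]
    exact fderiv_const_mul (p.differentiableAt_eval x) c

lemma polyDifferential_mul (x : σ → 𝕜) (p q : MvPolynomial σ 𝕜) :
    polyDifferential x (p * q) =
      eval x p • polyDifferential x q + eval x q • polyDifferential x p := by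
  change fderiv 𝕜 (fun y => eval y (p * q)) x = _
  simp only [map_mul]
  exact fderiv_fun_mul (p.differentiableAt_eval x) (q.differentiableAt_eval x)

lemma polyDifferential_C (x : σ → 𝕜) (c : 𝕜) : polyDifferential x (C c) = 0 := by
  change fderiv 𝕜 (fun y => eval y (C c)) x = _
  simp

lemma polyDifferential_eq_zero (x : σ → 𝕜) {p : MvPolynomial σ 𝕜}
    (hp : p ∈ RingHom.ker (eval x) ^ 2) : polyDifferential x p = 0 := by
  rw [pow_two] at hp
  refine Submodule.mul_induction_on hp (fun a ha b hb => ?_) fun a b ha hb => ?_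
  · have ha' : eval x a = (0 : 𝕜) := ha
    have hb' : eval x b = (0 : 𝕜) := hb
    rw [polyDifferential_mul, ha', hb']
    ext v
    simp
  · rw [map_add, ha, hb, add_zero]

end Differentials

/-! ### The Euler derivation -/

section Euler

variable (𝕜 : Type*) [RCLike 𝕜] {n : ℕ}

/-- The change of coefficients from `ℤ` to `𝕜`. -/
noncomputable def coeffMap (n : ℕ) :
    MvPolynomial (ZMod (2 * n)) ℤ →+* MvPolynomial (ZMod (2 * n)) 𝕜 :=
  MvPolynomial.map (Int.castRingHom 𝕜)

lemma eval_coeffMap (x : ZMod (2 * n) → 𝕜) (p : MvPolynomial (ZMod (2 * n)) ℤ) :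
    eval x (coeffMap 𝕜 n p) = aeval x p := by
  rw [coeffMap, eval_map, aeval_def]
  rfl

/-- The derivation `∑ (-1)^k x_k ∂_k`. -/
noncomputable def eulerDerivation (n : ℕ) :
    Derivation 𝕜 (MvPolynomial (ZMod (2 * n)) 𝕜) (MvPolynomial (ZMod (2 * n)) 𝕜) :=
  mkDerivation 𝕜 fun k => (indexSign n k : MvPolynomial (ZMod (2 * n)) 𝕜) * X k

/-- `p` is an eigenvector of the Euler derivation with eigenvalue `w`. -/
def HasWeight (w : ℤ) (p : MvPolynomial (ZMod (2 * n)) ℤ) : Prop :=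
  eulerDerivation 𝕜 n (coeffMap 𝕜 n p) = (w : MvPolynomial (ZMod (2 * n)) 𝕜) * coeffMap 𝕜 n p

variable {𝕜}

lemma hasWeight_X (k : ZMod (2 * n)) : HasWeight 𝕜 (indexSign n k) (X k) := by
  simp [HasWeight, coeffMap, eulerDerivation]

lemma HasWeight.mul {w w' : ℤ} {p q : MvPolynomial (ZMod (2 * n)) ℤ} (hp : HasWeight 𝕜 w p)
    (hq : HasWeight 𝕜 w' q) : HasWeight 𝕜 (w + w') (p * q) := by
  unfold HasWeight at *
  rw [map_mul, Derivation.leibniz, hp, hq]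
  push_cast
  simp only [smul_eq_mul]
  ring

lemma hasWeight_one : HasWeight 𝕜 0 (1 : MvPolynomial (ZMod (2 * n)) ℤ) := by
  simp [HasWeight]

lemma hasWeight_prod {ι : Type*} (s : Finset ι) (w : ℤ) (f : ι → MvPolynomial (ZMod (2 * n)) ℤ)
    (h : ∀ i ∈ s, HasWeight 𝕜 w (f i)) : HasWeight 𝕜 (s.card * w) (∏ i ∈ s, f i) := by
  classical
  induction s using Finset.induction_on with
  | empty => simpa using hasWeight_one
  | insert i s hi ih =>
    rw [Finset.prod_insert hi, Finset.card_insert_of_notMem hi]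
    have := (h i (Finset.mem_insert_self i s)).mul
      (ih fun j hj => h j (Finset.mem_insert_of_mem hj))
    convert this using 1
    push_cast
    ring

lemma hasWeight_sum {ι : Type*} (s : Finset ι) (w : ℤ) (f : ι → MvPolynomial (ZMod (2 * n)) ℤ)
    (h : ∀ i ∈ s, HasWeight 𝕜 w (f i)) : HasWeight 𝕜 w (∑ i ∈ s, f i) := by
  unfold HasWeight at *
  rw [map_sum, map_sum, Finset.mul_sum]
  exact Finset.sum_congr rfl h

lemma hasWeight_neg_one_pow (k : ℕ) :
    HasWeight 𝕜 0 ((-1) ^ k : MvPolynomial (ZMod (2 * n)) ℤ) := by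
  rcases neg_one_pow_eq_or (MvPolynomial (ZMod (2 * n)) ℤ) k with h | h <;> rw [h] <;>
    simp [HasWeight]

/-- The signs of the three indices alternate, so one neighbour cancels the centre. Hence X_i has the
same weight as the x_j of opposite parity, and all factors of an admissible monomial weigh the same.
-/
lemma hasWeight_elemMonomial (k : ZMod (2 * n)) :
    HasWeight 𝕜 (- indexSign n k) (elemMonomial n k) := by
  have h : indexSign n (k - 1) = - indexSign n k := by
    have := indexSign_add_one (n := n) (k - 1)
    rw [sub_add_cancel] at this
    rw [this, neg_neg]
  have := ((hasWeight_X (𝕜 := 𝕜) (k - 1)).mul (hasWeight_X k)).mul (hasWeight_X (k + 1))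
  rwa [indexSign_add_one, h, neg_add_cancel, zero_add] at this

lemma hasWeight_admissibleSum [NeZero n] {P : ZMod (2 * n) → Prop} {w : ℤ}
    (h1 : ∀ i, P i → indexSign n i = -w) (h2 : ∀ i, ¬ P i → indexSign n i = w) (k : ℕ) :
    HasWeight 𝕜 (k * w) (admissibleSum n P k) := by
  classical
  unfold admissibleSum
  refine hasWeight_sum _ _ _ fun S hS => ?_
  obtain ⟨-, hA, hB, hk, -⟩ := Finset.mem_filter.1 hS
  have := (hasWeight_neg_one_pow (𝕜 := 𝕜) (n := n) S.2.card).mul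
    ((hasWeight_prod S.1 w (fun i => elemMonomial n i) fun i hi => by
      have := hasWeight_elemMonomial (𝕜 := 𝕜) i
      rwa [h1 i (hA i hi), neg_neg] at this).mul
    (hasWeight_prod S.2 w (fun i => X i) fun i hi => by
      have := hasWeight_X (𝕜 := 𝕜) i
      rwa [h2 i (hB i hi)] at this))
  convert this using 1
  rw [← hk]
  push_cast
  ring

lemma indexSign_of_even {k : ZMod (2 * n)} (h : Even k) : indexSign n k = 1 := by
  simp [indexSign, h]

lemma indexSign_of_not_even {k : ZMod (2 * n)} (h : ¬ Even k) : indexSign n k = -1 := by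
  simp [indexSign, h]

lemma hasWeight_polyE [NeZero n] (k : ℕ) : HasWeight 𝕜 k (polyE n k) := by
  have := hasWeight_admissibleSum (𝕜 := 𝕜) (n := n) (P := fun i => ¬ Even i) (w := 1)
    (fun i hi => indexSign_of_not_even hi) (fun i hi => indexSign_of_even (not_not.1 hi)) k
  rwa [mul_one] at this

lemma hasWeight_polyO [NeZero n] (k : ℕ) : HasWeight 𝕜 (-k) (polyO n k) := by
  have := hasWeight_admissibleSum (𝕜 := 𝕜) (n := n) (P := fun i => Even i) (w := -1)
    (fun i hi => by rw [indexSign_of_even hi, neg_neg]) (fun i hi => indexSign_of_not_even hi) k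
  rwa [mul_neg_one] at this

lemma hasWeight_polyETop [NeZero n] : HasWeight 𝕜 n (polyETop n) := by
  rw [polyETop_eq]
  have := hasWeight_prod (𝕜 := 𝕜) Finset.univ 1 (fun i : ZMod n => X (doubling n i)) fun i _ => by
    have := hasWeight_X (𝕜 := 𝕜) (doubling n i)
    rwa [indexSign_of_even ((even_iff_exists_doubling _).2 ⟨i, rfl⟩)] at this
  rwa [Finset.card_univ, ZMod.card, mul_one] at this

lemma hasWeight_polyOTop [NeZero n] : HasWeight 𝕜 (-n) (polyOTop n) := by
  rw [polyOTop_eq]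
  have := hasWeight_prod (𝕜 := 𝕜) Finset.univ (-1)
    (fun i : ZMod n => X (doubling n i - 1)) fun i _ => by
      have := hasWeight_X (𝕜 := 𝕜) (doubling n i - 1)
      rwa [indexSign_of_not_even ((even_or_even_sub_one _).2 ⟨i, rfl⟩)] at this
  rwa [Finset.card_univ, ZMod.card, mul_neg_one] at this

end Euler

/-! ### The invariant of degree zero, and cube roots -/

lemma admissibleSum_zero {n : ℕ} [NeZero n] (P : ZMod (2 * n) → Prop) :
    admissibleSum n P 0 = 1 := by
  classical
  unfold admissibleSum
  rw [Finset.sum_eq_single (∅, ∅)]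
  · simp
  · rintro ⟨A, B⟩ hS hne
    simp at hS
    simp [hS] at hne
  · intro h
    simp [IsAdmissible] at h

lemma RCLike.exists_cube_root {𝕜 : Type*} [RCLike 𝕜] (z : 𝕜) : ∃ o : 𝕜, o ^ 3 = z := by
  rcases RCLike.I_eq_zero_or_im_I_eq_one (K := 𝕜) with h | h
  · have hs (y : ℝ) : ∃ t : ℝ, t ^ 3 = y := by
      rcases le_total 0 y with hy | hy
      · exact ⟨y ^ ((3 : ℕ) : ℝ)⁻¹, Real.rpow_inv_natCast_pow hy (by norm_num)⟩
      · refine ⟨-(-y) ^ ((3 : ℕ) : ℝ)⁻¹, ?_⟩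
        rw [Odd.neg_pow (by decide), Real.rpow_inv_natCast_pow (neg_nonneg.2 hy) (by norm_num),
          neg_neg]
    obtain ⟨t, ht⟩ := hs (RCLike.realRingEquiv h z)
    refine ⟨(RCLike.realRingEquiv h).symm t, ?_⟩
    rw [← map_pow]
    exact (RingEquiv.symm_apply_eq _).2 ht
  · obtain ⟨t, ht⟩ := IsAlgClosed.exists_pow_nat_eq (RCLike.complexRingEquiv h z)
      (by norm_num : 0 < 3)
    refine ⟨(RCLike.complexRingEquiv h).symm t, ?_⟩
    rw [← map_pow, ht, RingEquiv.symm_apply_apply]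

/-! ### Identities at a point with scalar monodromy -/

section Identities

variable {𝕜 : Type*} [RCLike 𝕜] {n : ℕ}

/-- The weighted sum `∑ k ^ j p_k`, over `𝕜`. -/
noncomputable def weightedSum (𝕜 : Type*) [RCLike 𝕜] (n : ℕ)
    (p : ℕ → MvPolynomial (ZMod (2 * n)) ℤ) (j : ℕ) : MvPolynomial (ZMod (2 * n)) 𝕜 :=
  ∑ k ∈ Finset.range (n / 2 + 1), (k : 𝕜) ^ j • coeffMap 𝕜 n (p k)

lemma euler_weightedSum {p : ℕ → MvPolynomial (ZMod (2 * n)) ℤ} {s : ℤ}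
    (hp : ∀ k : ℕ, HasWeight 𝕜 (s * k) (p k)) (j : ℕ) :
    eulerDerivation 𝕜 n (weightedSum 𝕜 n p j) = (s : 𝕜) • weightedSum 𝕜 n p (j + 1) := by
  rw [weightedSum, map_sum, weightedSum, Finset.smul_sum]
  refine Finset.sum_congr rfl fun k _ => ?_
  rw [Derivation.map_smul, hp k, smul_smul]
  simp only [smul_eq_C_mul, map_mul, map_pow, map_natCast, map_intCast]
  push_cast
  ring

/-- With 0 ^ 0 = 1 the term k = 0 is kept here, while it drops out for every positive exponent. -/
lemma weightedSum_zero (p : ℕ → MvPolynomial (ZMod (2 * n)) ℤ) :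
    weightedSum 𝕜 n p 0 = coeffMap 𝕜 n (∑ k ∈ Finset.range (n / 2 + 1), p k) := by
  simp [weightedSum]

lemma sum_range_succ_eq_sum_Icc {M : Type*} [AddCommMonoid M] (m : ℕ) (f : ℕ → M) (h : f 0 = 0) :
    ∑ k ∈ Finset.range (m + 1), f k = ∑ k ∈ Finset.Icc 1 m, f k := by
  symm
  refine Finset.sum_subset (fun k hk => ?_) fun k hk hk' => ?_
  · rw [Finset.mem_Icc] at hk
    exact Finset.mem_range.2 (by omega)
  · rw [Finset.mem_range] at hk
    rw [Finset.mem_Icc] at hk'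
    rw [show k = 0 by omega, h]

lemma map_transferMatrix {R S : Type*} [CommRing R] [CommRing S] (f : R →+* S) (a b : R) :
    f.mapMatrix (transferMatrix a b) = transferMatrix (f a) (f b) := by
  ext i j
  fin_cases i <;> fin_cases j <;> simp [transferMatrix]

/-- The relations between the monodromy invariants modulo powers of the ideal of a point with
scalar monodromy. -/
lemma relations_mod_pow [NeZero n] (hn : 5 ≤ n) {x : ZMod (2 * n) → 𝕜} {c : 𝕜}
    (hc : orderedProd (fun i : ℕ =>
      transferMatrix (x (doubling n i)) (x (doubling n i - 1))) n = c • 1)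
    {E O T R : MvPolynomial (ZMod (2 * n)) 𝕜} (hE : E = coeffMap 𝕜 n (polyETop n))
    (hO : O = coeffMap 𝕜 n (polyOTop n)) (hT : T = weightedSum 𝕜 n (polyE n) 0)
    (hR : R = weightedSum 𝕜 n (polyO n) 0) :
    (eval x T = 3 * c ∧ eval x (E * R) = 3 * c ^ 2 ∧ eval x (E ^ 2 * O) = c ^ 3) ∧
      E ^ 2 * O - C c ^ 2 * T + 2 * C c ^ 3 ∈ RingHom.ker (eval x) ^ 2 ∧
      E * R - 2 * C c * T + 3 * C c ^ 2 ∈ RingHom.ker (eval x) ^ 2 ∧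
      C c ^ 3 - C c ^ 2 * T + C c * (E * R) - E ^ 2 * O ∈ RingHom.ker (eval x) ^ 3 := by
  set M := (coeffMap 𝕜 n).mapMatrix (monodromy n) with hM
  have hMx : (eval x).mapMatrix M = c • 1 := by
    rw [← hc, hM, monodromy, map_orderedProd, map_orderedProd]
    refine orderedProd_congr fun i _ => ?_
    rw [map_transferMatrix, map_transferMatrix]
    simp [coeffMap]
  have htr : T = M.trace := by
    rw [hT, weightedSum_zero, ← trace_monodromy hn]
    exact AddMonoidHom.map_trace (coeffMap 𝕜 n) (monodromy n)
  have hdet : E ^ 2 * O = M.det := by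
    rw [hE, hO, hM, ← RingHom.map_det, det_monodromy, map_mul, map_pow]
  have hadj : E * R = M.adjugate.trace := by
    rw [hE, hR, weightedSum_zero, ← map_mul, ← trace_adjugate_monodromy hn, hM,
      ← RingHom.map_adjugate]
    exact AddMonoidHom.map_trace (coeffMap 𝕜 n) (monodromy n).adjugate
  -- Scalar monodromy at the point means that the entries of M - c lie in the maximal ideal of the
  -- point.
  have key := Matrix.invariants_of_congr_scalar (RingHom.ker (eval x)) M (C c) (by
    intro i j
    have := congrFun (congrFun hMx i) j
    rw [RingHom.mapMatrix_apply, Matrix.map_apply] at this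
    rw [RingHom.mem_ker, Matrix.sub_apply, map_sub, this]
    rcases eq_or_ne i j with rfl | h
    · simp
    · simp [h])
  rw [htr, hdet, hadj]
  refine ⟨⟨?_, ?_, ?_⟩, key⟩
  · rw [show eval x M.trace = ((eval x).mapMatrix M).trace from AddMonoidHom.map_trace (eval x) M,
      hMx]
    simp [mul_comm]
  · rw [show eval x M.adjugate.trace = ((eval x).mapMatrix M.adjugate).trace from
      AddMonoidHom.map_trace (eval x) _, RingHom.map_adjugate, hMx, Matrix.adjugate_smul]
    simp [mul_comm]
  · rw [RingHom.map_det, hMx]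
    simp

/-- The values and the differentials of the weighted sums of the monodromy invariants at a point
with scalar monodromy. -/
lemma relations_at_point [NeZero n] (hn : 5 ≤ n) {x : ZMod (2 * n) → 𝕜} {c : 𝕜}
    (hc : orderedProd (fun i : ℕ =>
      transferMatrix (x (doubling n i)) (x (doubling n i - 1))) n = c • 1)
    {E O : MvPolynomial (ZMod (2 * n)) 𝕜} {T R : ℕ → MvPolynomial (ZMod (2 * n)) 𝕜}
    (hE : E = coeffMap 𝕜 n (polyETop n))
    (hO : O = coeffMap 𝕜 n (polyOTop n)) (hT : T = weightedSum 𝕜 n (polyE n))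
    (hR : R = weightedSum 𝕜 n (polyO n)) :
    (eval x (T 0) = 3 * c ∧ eval x E * eval x (R 0) = 3 * c ^ 2 ∧
      eval x E ^ 2 * eval x O = c ^ 3) ∧
    (n * (eval x E ^ 2 * eval x O) - c ^ 2 * eval x (T 1) = 0 ∧
      eval x E * (n * eval x (R 0) - eval x (R 1)) - 2 * c * eval x (T 1) = 0 ∧
      c * (eval x E * (n ^ 2 * eval x (R 0) - 2 * n * eval x (R 1) + eval x (R 2))) -
        c ^ 2 * eval x (T 2) - n ^ 2 * (eval x E ^ 2 * eval x O) = 0) ∧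
    ∀ v, (2 * eval x E * eval x O * polyDifferential x E v +
        eval x E ^ 2 * polyDifferential x O v - c ^ 2 * polyDifferential x (T 0) v = 0 ∧
      eval x (R 0) * polyDifferential x E v + eval x E * polyDifferential x (R 0) v -
        2 * c * polyDifferential x (T 0) v = 0 ∧
      c * ((n * eval x (R 0) - eval x (R 1)) * polyDifferential x E v +
          eval x E * (n * polyDifferential x (R 0) v - polyDifferential x (R 1) v)) -
        c ^ 2 * polyDifferential x (T 1) v -
        n * (2 * eval x E * eval x O * polyDifferential x E v +
          eval x E ^ 2 * polyDifferential x O v) = 0) := by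
  obtain ⟨⟨h1, h2, h3⟩, hG1, hG2, hF⟩ := relations_mod_pow hn hc hE hO (congrFun hT 0)
    (congrFun hR 0)
  set ξ := eulerDerivation 𝕜 n with hξ
  set N : MvPolynomial (ZMod (2 * n)) 𝕜 := (n : MvPolynomial (ZMod (2 * n)) 𝕜) with hN
  have ξT (j : ℕ) : ξ (T j) = T (j + 1) := by
    have := euler_weightedSum (𝕜 := 𝕜) (p := polyE n) (s := 1)
      (fun k => by simpa using hasWeight_polyE k) j
    rw [hT]
    simpa using this
  have ξR (j : ℕ) : ξ (R j) = - R (j + 1) := by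
    have := euler_weightedSum (𝕜 := 𝕜) (p := polyO n) (s := -1)
      (fun k => by simpa using hasWeight_polyO k) j
    rw [hR]
    simpa using this
  have ξE : ξ E = N * E := by
    have := hasWeight_polyETop (𝕜 := 𝕜) (n := n)
    rw [HasWeight, ← hE] at this
    simpa using this
  have ξO : ξ O = - N * O := by
    have := hasWeight_polyOTop (𝕜 := 𝕜) (n := n)
    rw [HasWeight, ← hO] at this
    simpa using this
  have ξC (a : 𝕜) : ξ (C a) = 0 := ξ.map_algebraMap a
  have ξn (m : ℕ) : ξ (m : MvPolynomial (ZMod (2 * n)) 𝕜) = 0 := ξ.map_natCast m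
  have ξ2 : ξ (2 : MvPolynomial (ZMod (2 * n)) 𝕜) = 0 := by exact_mod_cast ξn 2
  have ξ3 : ξ (3 : MvPolynomial (ZMod (2 * n)) 𝕜) = 0 := by exact_mod_cast ξn 3
  have ξN : ξ N = 0 := ξn n
  have hNx : eval x N = n := by simp [hN]
  have e1 : ξ (E ^ 2 * O - C c ^ 2 * T 0 + 2 * C c ^ 3) = N * (E ^ 2 * O) - C c ^ 2 * T 1 := by
    simp only [map_add, map_sub, Derivation.leibniz, Derivation.leibniz_pow, ξT, ξE, ξO, ξC, ξ2,
      smul_eq_mul, nsmul_eq_mul]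
    ring
  have e2 : ξ (E * R 0 - 2 * C c * T 0 + 3 * C c ^ 2) =
      E * (N * R 0 - R 1) - 2 * C c * T 1 := by
    simp only [map_add, map_sub, Derivation.leibniz, Derivation.leibniz_pow, ξT, ξR, ξE, ξC, ξ2,
      ξ3, smul_eq_mul, nsmul_eq_mul]
    ring
  have e3 : ξ (C c ^ 3 - C c ^ 2 * T 0 + C c * (E * R 0) - E ^ 2 * O) =
      C c * (E * (N * R 0 - R 1)) - C c ^ 2 * T 1 - N * (E ^ 2 * O) := by
    simp only [map_add, map_sub, Derivation.leibniz, Derivation.leibniz_pow, ξT, ξR, ξE, ξO, ξC,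
      smul_eq_mul, nsmul_eq_mul]
    ring
  have e4 : ξ (C c * (E * (N * R 0 - R 1)) - C c ^ 2 * T 1 - N * (E ^ 2 * O)) =
      C c * (E * (N ^ 2 * R 0 - 2 * N * R 1 + R 2)) - C c ^ 2 * T 2 - N ^ 2 * (E ^ 2 * O) := by
    simp only [map_sub, Derivation.leibniz, Derivation.leibniz_pow, ξT, ξR, ξE, ξO, ξC,
      ξN, smul_eq_mul, nsmul_eq_mul]
    ring
  have m1 := ξ.apply_mem_pow _ 1 hG1
  have m2 := ξ.apply_mem_pow _ 1 hG2
  -- ξF ∈ I² serves twice: a second ξ gives the quadratic value identity, and its differential gives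
  -- the last covector identity.
  have m3 := ξ.apply_mem_pow _ 2 hF
  rw [e3] at m3
  have m4 := ξ.apply_mem_pow _ 1 m3
  rw [e1, pow_one, RingHom.mem_ker] at m1
  rw [e2, pow_one, RingHom.mem_ker] at m2
  rw [e4, pow_one, RingHom.mem_ker] at m4
  refine ⟨⟨h1, by simpa using h2, by simpa using h3⟩, ⟨by simpa [hNx] using m1, by simpa [hNx] using m2,
    by simpa [hNx] using m4⟩, fun v => ?_⟩
  have dC (a : 𝕜) := polyDifferential_C x a
  have dN : polyDifferential x N = 0 := by
    rw [hN, ← map_natCast C]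
    exact polyDifferential_C x _
  have dn (m : ℕ) : polyDifferential x (m : MvPolynomial (ZMod (2 * n)) 𝕜) = 0 := by
    rw [← map_natCast C]
    exact dC _
  have d2 : polyDifferential x (2 : MvPolynomial (ZMod (2 * n)) 𝕜) = 0 := by exact_mod_cast dn 2
  have d3 : polyDifferential x (3 : MvPolynomial (ZMod (2 * n)) 𝕜) = 0 := by exact_mod_cast dn 3
  have f1 := congrArg (· v) (polyDifferential_eq_zero x hG1)
  have f2 := congrArg (· v) (polyDifferential_eq_zero x hG2)
  have f3 := congrArg (· v) (polyDifferential_eq_zero x m3)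
  simp [pow_succ, polyDifferential_mul, dC, dN, hNx, d2, d3] at f1 f2 f3
  refine ⟨?_, ?_, ?_⟩
  · linear_combination f1
  · linear_combination f2
  · linear_combination f3

/-- The relations at the point after substituting E_n = e³, O_n = o³ and c = e²o; they are
triangular in the unknown sums, up to nonzero monomials in e and o. -/
lemma value_identities {K : Type*} [Field K] {N e o T₀ T₁ T₂ R₀ R₁ R₂ : K} (he : e ≠ 0)
    (ho : o ≠ 0) (h1 : T₀ = 3 * (e ^ 2 * o)) (h2 : e ^ 3 * R₀ = 3 * (e ^ 2 * o) ^ 2)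
    (h4 : N * ((e ^ 3) ^ 2 * o ^ 3) - (e ^ 2 * o) ^ 2 * T₁ = 0)
    (h5 : e ^ 3 * (N * R₀ - R₁) - 2 * (e ^ 2 * o) * T₁ = 0)
    (h6 : (e ^ 2 * o) * (e ^ 3 * (N ^ 2 * R₀ - 2 * N * R₁ + R₂)) - (e ^ 2 * o) ^ 2 * T₂ -
      N ^ 2 * ((e ^ 3) ^ 2 * o ^ 3) = 0) :
    R₀ = 3 * e * o ^ 2 ∧ T₀ = 3 * e ^ 2 * o ∧ R₁ = N * e * o ^ 2 ∧ T₁ = N * e ^ 2 * o ∧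
      e * R₂ = o * T₂ := by
  have k0 : R₀ = 3 * e * o ^ 2 := by
    refine mul_left_cancel₀ (pow_ne_zero 3 he) ?_
    linear_combination h2
  have k1 : T₁ = N * e ^ 2 * o := by
    refine mul_left_cancel₀ (pow_ne_zero 2 (mul_ne_zero (pow_ne_zero 2 he) ho)) ?_
    linear_combination -h4
  subst k0 k1
  have k2 : R₁ = N * e * o ^ 2 := by
    refine mul_left_cancel₀ (pow_ne_zero 3 he) ?_
    linear_combination -h5
  subst k2
  refine ⟨rfl, by rw [h1]; ring, rfl, rfl, ?_⟩
  refine mul_left_cancel₀ (mul_ne_zero (pow_ne_zero 4 he) ho) ?_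
  linear_combination h6

lemma differential_identities {K : Type*} [Field K] {N e o E O t₀ t₁ r₀ r₁ : K} (he : e ≠ 0)
    (ho : o ≠ 0)
    (h1 : 2 * e ^ 3 * o ^ 3 * E + (e ^ 3) ^ 2 * O - (e ^ 2 * o) ^ 2 * t₀ = 0)
    (h2 : (3 * e * o ^ 2) * E + e ^ 3 * r₀ - 2 * (e ^ 2 * o) * t₀ = 0)
    (h3 : (e ^ 2 * o) * ((N * (3 * e * o ^ 2) - N * e * o ^ 2) * E + e ^ 3 * (N * r₀ - r₁)) -
      (e ^ 2 * o) ^ 2 * t₁ - N * (2 * e ^ 3 * o ^ 3 * E + (e ^ 3) ^ 2 * O) = 0) :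
    r₀ = 2 * e * o⁻¹ * O + e⁻¹ ^ 2 * o ^ 2 * E ∧ t₀ = 2 * e⁻¹ * o * E + e ^ 2 * o⁻¹ ^ 2 * O ∧
      o * t₁ + e * r₁ = N * e ^ 2 * o ^ 2 * ((e ^ 3)⁻¹ * E + (o ^ 3)⁻¹ * O) := by
  have k0 : t₀ = 2 * e⁻¹ * o * E + e ^ 2 * o⁻¹ ^ 2 * O := by
    field_simp
    refine mul_left_cancel₀ (pow_ne_zero 3 he) ?_
    linear_combination -h1
  have k1 : r₀ = 2 * e * o⁻¹ * O + e⁻¹ ^ 2 * o ^ 2 * E := by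
    rw [k0] at h2
    field_simp at h2 ⊢
    refine mul_left_cancel₀ he ?_
    linear_combination h2
  refine ⟨k1, k0, ?_⟩
  rw [k1] at h3
  field_simp at h3 ⊢
  refine mul_left_cancel₀ (pow_ne_zero 3 he) ?_
  linear_combination -h3

end Identities

/-! ### From weighted sums of polynomials to sums of invariants and of their differentials -/

section Translation

variable {𝕜 : Type*} [RCLike 𝕜] {n : ℕ}

lemma eval_weightedSum_zero (x : ZMod (2 * n) → 𝕜) (p : ℕ → MvPolynomial (ZMod (2 * n)) ℤ) :
    eval x (weightedSum 𝕜 n p 0) = ∑ k ∈ Finset.range (n / 2 + 1), aeval x (p k) := by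
  simp [weightedSum, eval_coeffMap]

lemma eval_weightedSum_succ (x : ZMod (2 * n) → 𝕜) (p : ℕ → MvPolynomial (ZMod (2 * n)) ℤ)
    (j : ℕ) : eval x (weightedSum 𝕜 n p (j + 1)) =
      ∑ k ∈ Finset.Icc 1 (n / 2), (k : 𝕜) ^ (j + 1) * aeval x (p k) := by
  rw [← sum_range_succ_eq_sum_Icc _ _ (by simp)]
  simp [weightedSum, eval_coeffMap]

lemma fderiv_aeval (x : ZMod (2 * n) → 𝕜) [NeZero n] (p : MvPolynomial (ZMod (2 * n)) ℤ) :
    fderiv 𝕜 (fun y : ZMod (2 * n) → 𝕜 => aeval y p) x =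
      polyDifferential x (coeffMap 𝕜 n p) := by
  simp only [← eval_coeffMap]
  rfl

lemma polyDifferential_weightedSum [NeZero n] (x : ZMod (2 * n) → 𝕜)
    (p : ℕ → MvPolynomial (ZMod (2 * n)) ℤ) (hp : p 0 = 1) (j : ℕ) :
    polyDifferential x (weightedSum 𝕜 n p j) = ∑ k ∈ Finset.Icc 1 (n / 2),
      (k : 𝕜) ^ j • fderiv 𝕜 (fun y : ZMod (2 * n) → 𝕜 => aeval y (p k)) x := by
  have h0 : polyDifferential x (((0 : ℕ) : 𝕜) ^ j • coeffMap 𝕜 n (p 0)) = 0 := by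
    rw [hp, map_one, map_smul, ← C_1, polyDifferential_C]
    ext v
    simp
  rw [weightedSum, map_sum, sum_range_succ_eq_sum_Icc _ _ h0]
  simp only [map_smul, fderiv_aeval]

end Translation

/-- Here `o = O_n^{1/3}` and `e = E_n^{1/3}`. For `𝕜 = ℝ` these are the unique real cube roots;
for `𝕜 = ℂ` the cube roots have to be chosen compatibly, and the same choice serves in all
eight identities. The differentials are those of functions on the whole coordinate space
`𝕜^{2n}` of twisted polygons, taken at the points of `𝒞_n`. -/
theorem mainTheorem5 (𝕜 : Type*) [RCLike 𝕜] (n : ℕ) [NeZero n] (hn : 5 ≤ n)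
    (x : ZMod (2 * n) → 𝕜) (hx : x ∈ closedPolygonLocus 𝕜 n) :
    ∃ o e : 𝕜, o ^ 3 = invOTop 𝕜 n x ∧ e ^ 3 = invETop 𝕜 n x ∧ o ≠ 0 ∧ e ≠ 0 ∧
      -- the five identities between the restrictions
      (∑ j ∈ Finset.range (n / 2 + 1), invO 𝕜 n j x = 3 * e * o ^ 2) ∧
      (∑ j ∈ Finset.range (n / 2 + 1), invE 𝕜 n j x = 3 * e ^ 2 * o) ∧
      (∑ j ∈ Finset.Icc 1 (n / 2), (j : 𝕜) * invO 𝕜 n j x = n * e * o ^ 2) ∧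
      (∑ j ∈ Finset.Icc 1 (n / 2), (j : 𝕜) * invE 𝕜 n j x = n * e ^ 2 * o) ∧
      (e * ∑ j ∈ Finset.Icc 1 (n / 2), (j : 𝕜) ^ 2 * invO 𝕜 n j x =
        o * ∑ j ∈ Finset.Icc 1 (n / 2), (j : 𝕜) ^ 2 * invE 𝕜 n j x) ∧
      -- the three identities between the differentials
      (∑ j ∈ Finset.Icc 1 (n / 2), fderiv 𝕜 (invO 𝕜 n j) x =
        (2 * e * o⁻¹) • fderiv 𝕜 (invOTop 𝕜 n) x +
          (e⁻¹ ^ 2 * o ^ 2) • fderiv 𝕜 (invETop 𝕜 n) x) ∧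
      (∑ j ∈ Finset.Icc 1 (n / 2), fderiv 𝕜 (invE 𝕜 n j) x =
        (2 * e⁻¹ * o) • fderiv 𝕜 (invETop 𝕜 n) x +
          (e ^ 2 * o⁻¹ ^ 2) • fderiv 𝕜 (invOTop 𝕜 n) x) ∧
      (o • (∑ j ∈ Finset.Icc 1 (n / 2), (j : 𝕜) • fderiv 𝕜 (invE 𝕜 n j) x) +
          e • (∑ j ∈ Finset.Icc 1 (n / 2), (j : 𝕜) • fderiv 𝕜 (invO 𝕜 n j) x) =
        (n * e ^ 2 * o ^ 2) •
          ((invETop 𝕜 n x)⁻¹ • fderiv 𝕜 (invETop 𝕜 n) x +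
            (invOTop 𝕜 n x)⁻¹ • fderiv 𝕜 (invOTop 𝕜 n) x)) := by
  classical
  obtain ⟨hx0, c, hc⟩ := monodromy_scalar hx
  have hO0 : invOTop 𝕜 n x ≠ 0 := by
    rw [invOTop, polyOTop_eq, map_prod]
    exact Finset.prod_ne_zero_iff.2 fun i _ => by simpa using hx0 _
  have hE0 : invETop 𝕜 n x ≠ 0 := by
    rw [invETop, polyETop_eq, map_prod]
    exact Finset.prod_ne_zero_iff.2 fun i _ => by simpa using hx0 _
  obtain ⟨⟨h1, h2, h3⟩, ⟨h4, h5, h6⟩, h7⟩ := relations_at_point hn hc rfl rfl rfl rfl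
  have pE0 : polyE n 0 = 1 := admissibleSum_zero _
  have pO0 : polyO n 0 = 1 := admissibleSum_zero _
  simp only [polyDifferential_weightedSum x _ pE0, polyDifferential_weightedSum x _ pO0,
    ← fderiv_aeval, eval_coeffMap, pow_zero, pow_one, one_smul] at h7
  simp only [eval_weightedSum_zero] at h1 h2 h5 h6 h7
  have s1 (p : ℕ → MvPolynomial (ZMod (2 * n)) ℤ) := eval_weightedSum_succ x p 0
  have s2 (p : ℕ → MvPolynomial (ZMod (2 * n)) ℤ) := eval_weightedSum_succ x p 1
  simp only [zero_add, pow_one, one_add_one_eq_two] at s1 s2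
  simp only [eval_coeffMap, s1, s2] at h2 h3 h4 h5 h6 h7
  have hc0 : c ≠ 0 := by
    rintro rfl
    rw [zero_pow three_ne_zero] at h3
    exact mul_ne_zero (pow_ne_zero 2 hE0) hO0 h3
  obtain ⟨o, ho⟩ := RCLike.exists_cube_root (invOTop 𝕜 n x)
  have ho0 : o ≠ 0 := by
    rintro rfl
    exact hO0 (by rw [← ho]; simp)
  -- The compatible choice of e is forced by c = e²o and e³ = E_n, which give e = E_n o / c; that
  -- its cube is E_n follows from c³ = E_n² O_n.
  obtain ⟨e, he, hce⟩ : ∃ e : 𝕜, e ^ 3 = invETop 𝕜 n x ∧ c = e ^ 2 * o := by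
    change invETop 𝕜 n x ^ 2 * invOTop 𝕜 n x = c ^ 3 at h3
    rw [← ho] at h3
    refine ⟨invETop 𝕜 n x * o / c, ?_, ?_⟩
    · rw [div_pow, div_eq_iff (pow_ne_zero 3 hc0)]
      linear_combination invETop 𝕜 n x * h3
    · field_simp
      linear_combination -h3
  have he0 : e ≠ 0 := by
    rintro rfl
    exact hE0 (by rw [← he]; simp)
  change _ = aeval x (polyETop n) at he
  change _ = aeval x (polyOTop n) at ho
  simp only [← he, ← ho, hce] at h1 h2 h4 h5 h6 h7
  obtain ⟨v1, v2, v3, v4, v5⟩ := value_identities he0 ho0 h1 h2 h4 h5 h6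
  -- ∑ O_j and ∑ j O_j occur as coefficients of dE_n, so the value identities must be inserted
  -- first.
  rw [v1, v3] at h7
  have d := fun v => differential_identities he0 ho0 (h7 v).1 (h7 v).2.1 (h7 v).2.2
  refine ⟨o, e, ho, he, ho0, he0, v1, v2, v3, v4, v5, ?_, ?_, ?_⟩
  · ext v
    exact (d v).1
  · ext v
    exact (d v).2.1
  · ext v
    have he' : invETop 𝕜 n x = e ^ 3 := he.symm
    have ho' : invOTop 𝕜 n x = o ^ 3 := ho.symm
    rw [he', ho']
    exact (d v).2.2
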